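/- Let $f:\widehat{\mathbb C}\to\widehat{\mathbb C}$ be a rational map of degree $d\ge 2$ of the Riemann sphere $\widehat{\mathbb C}=\mathbb C\cup\{\infty\}$. Let the Fatou set $\mathcal F_f$ be the largest open subset of $\widehat{\mathbb C}$ on which the family of iterates $(f^{\circ n})_{n\in\mathbb N}$ is normal (every sequence of members of the family has a subsequence converging uniformly, for the spherical metric, on compact subsets), let the Julia set be $\mathcal J_f=\widehat{\mathbb C}\setminus\mathcal F_f$, and let the exceptional set $E_f$ be the largest finite set $E\subset\widehat{\mathbb C}$ that is completely invariant, i.e. $f(E)=E$ and $f^{-1}(E)=E$. For $z\in\widehat{\mathbb C}$ let $\mathcal O^-(z)=\bigcup_{m\ge 0}f^{-m}\{z\}$ be its backward orbit, where $f^{-m}\{z\}=\{w : f^{\circ m}(w)=z\}$. Then: 1. for every $z\in\widehat{\mathbb C}\setminus E_f$, $\mathcal J_f\subseteq\overline{\mathcal O^-(z)}$; 2. $\mathcal J_f$ is perfect, i.e. closed and without isolated points, and $\mathcal J_f$ is uncountable. -/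

import Mathlib

noncomputable section

namespace RationalDynamics

open scoped OnePoint

/-- The Riemann sphere `ℂ ∪ {∞}`, with the topology of the one-point compactification. -/
abbrev Sphere : Type := OnePoint ℂ

/-- The spherical (great-circle) distance on the Riemann sphere, identified with the unit sphere
of `ℝ³` by stereographic projection: the length distance of `2 |dz| / (1 + |z|²)`. The argument of
`2 * arcsin` is half the length of the chord between the two points. -/
def sphericalDist : Sphere → Sphere → ℝ
  | ∞, ∞ => 0
  | ∞, (w : ℂ) => 2 * Real.arcsin (1 / √(1 + ‖w‖ ^ 2))
  | (z : ℂ), ∞ => 2 * Real.arcsin (1 / √(1 + ‖z‖ ^ 2))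
  | (z : ℂ), (w : ℂ) =>
      2 * Real.arcsin (‖z - w‖ / (√(1 + ‖z‖ ^ 2) * √(1 + ‖w‖ ^ 2)))

open Classical in
/-- The self-map of the Riemann sphere given by a rational function `P / Q` in lowest terms.
At a finite point it is `P z / Q z`, or `∞` where `Q` vanishes. At `∞` it is the limit of
`P z / Q z` as `z → ∞`: this is `∞` if `deg Q < deg P`, and otherwise the quotient of the
coefficients of degree `deg Q` of `P` and `Q`. -/
def ratMap (f : RatFunc ℂ) : Sphere → Sphere
  | ∞ => if f.denom.natDegree < f.num.natDegree then ∞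
      else ((f.num.coeff f.denom.natDegree / f.denom.leadingCoeff : ℂ) : Sphere)
  | (z : ℂ) => if f.denom.eval z = 0 then ∞
      else ((f.num.eval z / f.denom.eval z : ℂ) : Sphere)

open Classical in
theorem ratMap_infty (f : RatFunc ℂ) :
    ratMap f ∞ = if f.denom.natDegree < f.num.natDegree then ∞
      else ((f.num.coeff f.denom.natDegree / f.denom.leadingCoeff : ℂ) : Sphere) := rfl

open Classical in
theorem ratMap_coe (f : RatFunc ℂ) (z : ℂ) :
    ratMap f (z : Sphere) = if f.denom.eval z = 0 then ∞
      else ((f.num.eval z / f.denom.eval z : ℂ) : Sphere) := rfl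

/-- The degree of a rational map `P / Q` in lowest terms: `max (deg P) (deg Q)`. -/
def ratDegree (f : RatFunc ℂ) : ℕ := max f.num.natDegree f.denom.natDegree

/-- `F n → g` uniformly on compact subsets of `U`, for the spherical distance in the range. -/
def ConvergesOnCompacts (F : ℕ → Sphere → Sphere) (g : Sphere → Sphere) (U : Set Sphere) : Prop :=
  ∀ K ⊆ U, IsCompact K → ∀ ε > 0, ∃ N, ∀ n ≥ N, ∀ z ∈ K, sphericalDist (F n z) (g z) < ε

/-- The family `F`, restricted to `U`, is normal: every sequence of members of the family has a
subsequence that converges uniformly on compact subsets of `U`. -/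
def IsNormalOn {ι : Type*} (F : ι → Sphere → Sphere) (U : Set Sphere) : Prop :=
  ∀ a : ℕ → ι, ∃ φ : ℕ → ℕ, StrictMono φ ∧
    ∃ g : Sphere → Sphere, ConvergesOnCompacts (fun k => F (a (φ k))) g U

/-- The Fatou set: the largest open set on which the family of iterates is normal, that is,
the union of all such open sets. -/
def fatouSet (f : Sphere → Sphere) : Set Sphere :=
  ⋃₀ {U | IsOpen U ∧ IsNormalOn (fun n : ℕ => f^[n]) U}

/-- The Julia set: the complement of the Fatou set. -/
def juliaSet (f : Sphere → Sphere) : Set Sphere := (fatouSet f)ᶜ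

/-- Complete invariance: `f(E) = E` and `f⁻¹(E) = E`. -/
def CompletelyInvariant (f : Sphere → Sphere) (E : Set Sphere) : Prop :=
  f '' E = E ∧ f ⁻¹' E = E

/-- The exceptional set: the largest finite completely invariant set, that is, the union of
all finite completely invariant sets. -/
def exceptionalSet (f : Sphere → Sphere) : Set Sphere :=
  ⋃₀ {E | E.Finite ∧ CompletelyInvariant f E}

/-- The backward orbit of `z`: the union over `m ≥ 0` of the sets `f⁻ᵐ{z}`. -/
def backwardOrbit (f : Sphere → Sphere) (z : Sphere) : Set Sphere :=
  ⋃ m : ℕ, f^[m] ⁻¹' {z}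

end RationalDynamics

end

/-! Everything rests on Montel's theorem: if the iterates omit three values near $p$, they are
equi-Lipschitz there, so $p$ is a Fatou point (`mem_fatouSet_of_omits`). The backward orbit of a
non-exceptional point is infinite, because a finite backward invariant set is completely invariant.
Off its closure no iterate takes a value in that orbit, so three values are omitted and the
complement of the closure is Fatou. This is part 1.

Montel's theorem is proved by Ahlfors' method (`ahlfors_schwarz`). A conformal metric on $\mathbb
C\setminus\{0,1\}$ with curvature below a negative constant is pulled back to a disc and compared
with the hyperbolic metric at a maximum of the ratio. As the metric dominates the spherical one, the
spherical derivative is bounded.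

For part 2, suppose first that the Julia set is empty. Then a subsequence of iterates is uniformly
Cauchy on the sphere, some positive iterates are uniformly close to the identity, and $f$ is
injective. An injective $f$ would contract quadratically at every point, hence be constant on the
plane (`not_injective_ratMap`). The same contraction makes exceptional points superattracting, hence
Fatou, so the Julia set cannot be finite: it would be completely invariant. By compactness it has an
accumulation point $z$. Since $f$ is open, the derived set of the Julia set contains $\mathcal
O^-(z)$. It is closed, so by part 1 it contains the whole Julia set. A nonempty perfect subset of a
compact metric space contains a Cantor set. -/

noncomputable section

namespace RationalDynamics

open scoped OnePoint
open Filter Topology Set Metric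

/-! ### Homogeneous coordinates and the chordal metric -/

/-- The determinant of two vectors of `ℂ²`. -/
def wedge (u v : ℂ × ℂ) : ℂ := u.1 * v.2 - u.2 * v.1

/-- The Hermitian norm on `ℂ²`. -/
def nrm (u : ℂ × ℂ) : ℝ := √(‖u.1‖ ^ 2 + ‖u.2‖ ^ 2)

open Classical in
/-- The point of the sphere with given homogeneous coordinates. -/
def proj (u : ℂ × ℂ) : Sphere := if u.2 = 0 then ∞ else ((u.1 / u.2 : ℂ) : Sphere)

/-- Standard homogeneous coordinates of a point of the sphere. -/
def lift : Sphere → ℂ × ℂ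
  | ∞ => (1, 0)
  | (z : ℂ) => (z, 1)

/-- The chordal distance, normalised to have diameter `1`. -/
def chord (p q : Sphere) : ℝ := ‖wedge (lift p) (lift q)‖ / (nrm (lift p) * nrm (lift q))

@[simp] theorem lift_infty : lift ∞ = (1, 0) := rfl
@[simp] theorem lift_coe (z : ℂ) : lift (z : Sphere) = (z, 1) := rfl

theorem lift_ne_zero (p : Sphere) : lift p ≠ 0 := by
  cases p using OnePoint.rec <;> simp [Prod.ext_iff]

theorem proj_lift (p : Sphere) : proj (lift p) = p := by
  cases p using OnePoint.rec <;> simp [proj]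

theorem nrm_sq (u : ℂ × ℂ) : nrm u ^ 2 = ‖u.1‖ ^ 2 + ‖u.2‖ ^ 2 := Real.sq_sqrt (by positivity)

theorem nrm_nonneg (u : ℂ × ℂ) : 0 ≤ nrm u := Real.sqrt_nonneg _

theorem nrm_pos {u : ℂ × ℂ} (hu : u ≠ 0) : 0 < nrm u := by
  apply Real.sqrt_pos.2
  by_contra! h
  have h1 : ‖u.1‖ ^ 2 = 0 := by nlinarith [sq_nonneg ‖u.1‖, sq_nonneg ‖u.2‖]
  have h2 : ‖u.2‖ ^ 2 = 0 := by nlinarith [sq_nonneg ‖u.1‖, sq_nonneg ‖u.2‖]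
  exact hu (Prod.ext (by simpa using h1) (by simpa using h2))

theorem nrm_smul (c : ℂ) (u : ℂ × ℂ) : nrm (c • u) = ‖c‖ * nrm u := by
  have : ‖(c • u).1‖ ^ 2 + ‖(c • u).2‖ ^ 2 = ‖c‖ ^ 2 * (‖u.1‖ ^ 2 + ‖u.2‖ ^ 2) := by
    simp only [Prod.smul_fst, Prod.smul_snd, smul_eq_mul, norm_mul]; ring
  rw [nrm, this, Real.sqrt_mul (by positivity), Real.sqrt_sq (norm_nonneg c), nrm]

theorem wedge_smul_smul (a b : ℂ) (u v : ℂ × ℂ) :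
    wedge (a • u) (b • v) = a * b * wedge u v := by
  simp only [wedge, Prod.smul_fst, Prod.smul_snd, smul_eq_mul]; ring

theorem wedge_swap (u v : ℂ × ℂ) : wedge u v = -wedge v u := by simp only [wedge]; ring

@[simp] theorem wedge_self (u : ℂ × ℂ) : wedge u u = 0 := by simp only [wedge]; ring

/-- Cauchy–Schwarz inequality in `ℂ²`. -/
theorem norm_add_mul_le (a b c d : ℂ) :
    ‖a * c + b * d‖ ≤ nrm (a, b) * nrm (c, d) := by
  refine (norm_add_le _ _).trans ?_
  rw [norm_mul, norm_mul]
  apply le_of_sq_le_sq _ (mul_nonneg (nrm_nonneg _) (nrm_nonneg _))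
  rw [mul_pow, nrm_sq, nrm_sq]
  nlinarith [sq_nonneg (‖a‖ * ‖d‖ - ‖b‖ * ‖c‖)]

theorem norm_wedge_le (u v : ℂ × ℂ) : ‖wedge u v‖ ≤ nrm u * nrm v := by
  have h := norm_add_mul_le u.1 u.2 v.2 (-v.1)
  have e : nrm (v.2, -v.1) = nrm v := by simp [nrm, add_comm]
  rw [e] at h
  convert h using 2
  simp only [wedge]; ring

theorem exists_lift_proj {u : ℂ × ℂ} (hu : u ≠ 0) : ∃ c : ℂ, c ≠ 0 ∧ lift (proj u) = c • u := by
  by_cases h : u.2 = 0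
  · have h1 : u.1 ≠ 0 := fun h1 => hu (Prod.ext h1 h)
    exact ⟨u.1⁻¹, inv_ne_zero h1, by simp [proj, h, Prod.ext_iff, h1]⟩
  · exact ⟨u.2⁻¹, inv_ne_zero h, by simp [proj, h, Prod.ext_iff, div_eq_inv_mul]⟩

theorem proj_smul {c : ℂ} (hc : c ≠ 0) (u : ℂ × ℂ) : proj (c • u) = proj u := by
  by_cases h : u.2 = 0
  · simp [proj, h]
  · simp [proj, h, hc, mul_div_mul_left]

theorem proj_eq_iff {u v : ℂ × ℂ} (hu : u ≠ 0) (hv : v ≠ 0) :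
    proj u = proj v ↔ wedge u v = 0 := by
  by_cases h : u.2 = 0
  · have h1 : u.1 ≠ 0 := fun h1 => hu (Prod.ext h1 h)
    by_cases h' : v.2 = 0
    · simp [proj, wedge, h, h']
    · simp [proj, wedge, h, h', h1]
  · by_cases h' : v.2 = 0
    · have h1 : v.1 ≠ 0 := fun h1 => hv (Prod.ext h1 h')
      simp [proj, wedge, h, h', h1]
    · simp only [proj, wedge, h, h', if_false, OnePoint.coe_eq_coe]
      rw [div_eq_div_iff h h', sub_eq_zero, mul_comm v.1]

theorem chord_proj {u v : ℂ × ℂ} (hu : u ≠ 0) (hv : v ≠ 0) :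
    chord (proj u) (proj v) = ‖wedge u v‖ / (nrm u * nrm v) := by
  obtain ⟨a, ha, hau⟩ := exists_lift_proj hu
  obtain ⟨b, hb, hbv⟩ := exists_lift_proj hv
  have := nrm_pos hu
  have := nrm_pos hv
  have := norm_pos_iff.2 ha
  have := norm_pos_iff.2 hb
  rw [chord, hau, hbv, wedge_smul_smul, nrm_smul, nrm_smul, norm_mul, norm_mul]
  field_simp

theorem chord_proj_right {v : ℂ × ℂ} (p : Sphere) (hv : v ≠ 0) :
    chord p (proj v) = ‖wedge (lift p) v‖ / (nrm (lift p) * nrm v) := by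
  rw [← chord_proj (lift_ne_zero p) hv, proj_lift]

theorem chord_nonneg (p q : Sphere) : 0 ≤ chord p q :=
  div_nonneg (norm_nonneg _) (mul_nonneg (nrm_nonneg _) (nrm_nonneg _))

theorem chord_le_one (p q : Sphere) : chord p q ≤ 1 :=
  div_le_one_of_le₀ (norm_wedge_le _ _) (mul_nonneg (nrm_nonneg _) (nrm_nonneg _))

theorem chord_comm (p q : Sphere) : chord p q = chord q p := by
  rw [chord, chord, wedge_swap, norm_neg, mul_comm]

theorem chord_self (p : Sphere) : chord p p = 0 := by simp [chord]

theorem eq_of_chord_eq_zero {p q : Sphere} (h : chord p q = 0) : p = q := by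
  have := nrm_pos (lift_ne_zero p)
  have := nrm_pos (lift_ne_zero q)
  rw [chord, div_eq_zero_iff, or_iff_left (by positivity), norm_eq_zero] at h
  rw [← proj_lift p, ← proj_lift q]
  exact (proj_eq_iff (lift_ne_zero p) (lift_ne_zero q)).2 h

/-- After multiplication by $|v|^2$, $u\wedge w$ is a combination of $v\wedge w$ and $u\wedge v$
whose coefficients are Hermitian products with $v$. Cauchy–Schwarz bounds these. -/
theorem chord_triangle (p q r : Sphere) : chord p r ≤ chord p q + chord q r := by
  have hp := nrm_pos (lift_ne_zero p)
  have hq := nrm_pos (lift_ne_zero q)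
  have hr := nrm_pos (lift_ne_zero r)
  simp only [chord]
  generalize lift p = u at *
  generalize lift q = v at *
  generalize lift r = w at *
  have hconj : ∀ x : ℂ × ℂ, ‖x.1 * starRingEnd ℂ v.1 + x.2 * starRingEnd ℂ v.2‖ ≤ nrm x * nrm v := by
    intro x
    have h := norm_add_mul_le x.1 x.2 (starRingEnd ℂ v.1) (starRingEnd ℂ v.2)
    have e : nrm (starRingEnd ℂ v.1, starRingEnd ℂ v.2) = nrm v := by simp [nrm]
    rwa [e] at h
  have key : wedge u w * ((nrm v ^ 2 : ℝ) : ℂ) =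
      (u.1 * starRingEnd ℂ v.1 + u.2 * starRingEnd ℂ v.2) * wedge v w +
      (w.1 * starRingEnd ℂ v.1 + w.2 * starRingEnd ℂ v.2) * wedge u v := by
    rw [nrm_sq]
    push_cast
    rw [← Complex.mul_conj', ← Complex.mul_conj']
    simp only [wedge]; ring
  have h1 : ‖wedge u w‖ * nrm v ^ 2 ≤ nrm u * nrm v * ‖wedge v w‖ + nrm w * nrm v * ‖wedge u v‖ := by
    have := congrArg norm key
    rw [norm_mul, Complex.norm_real, Real.norm_of_nonneg (by positivity)] at this
    rw [this]
    refine (norm_add_le _ _).trans ?_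
    rw [norm_mul, norm_mul]
    gcongr
    · exact hconj u
    · exact hconj w
  rw [div_add_div _ _ (by positivity) (by positivity), div_le_div_iff₀ (by positivity) (by positivity)]
  nlinarith [mul_le_mul_of_nonneg_left h1 (by positivity : 0 ≤ nrm u * nrm w)]

theorem sphericalDist_eq (p q : Sphere) : sphericalDist p q = 2 * Real.arcsin (chord p q) := by
  cases p using OnePoint.rec <;> cases q using OnePoint.rec <;>
    simp [sphericalDist, chord, wedge, nrm, add_comm]

/-- With `sphericalDist_le`, this lets the chordal distance replace the spherical one in every
question of normality. -/
theorem chord_le_sphericalDist (p q : Sphere) : chord p q ≤ sphericalDist p q := by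
  rw [sphericalDist_eq]
  have h0 := chord_nonneg p q
  have h : Real.sin (Real.arcsin (chord p q)) ≤ Real.arcsin (chord p q) :=
    Real.sin_le (Real.arcsin_nonneg.2 h0)
  rw [Real.sin_arcsin (by linarith) (chord_le_one p q)] at h
  linarith

theorem sphericalDist_le (p q : Sphere) : sphericalDist p q ≤ Real.pi * chord p q := by
  rw [sphericalDist_eq]
  have h0 := chord_nonneg p q
  have h := Real.mul_le_sin (Real.arcsin_nonneg.2 h0) (Real.arcsin_le_pi_div_two _)
  rw [Real.sin_arcsin (by linarith) (chord_le_one p q)] at h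
  have hpi := Real.pi_pos
  rw [div_mul_eq_mul_div, div_le_iff₀ hpi] at h
  linarith

theorem chord_coe_coe_le (z w : ℂ) : chord z w ≤ ‖z - w‖ := by
  have h : ∀ z : ℂ, 1 ≤ nrm (z, 1) := fun z => by
    rw [nrm, Real.one_le_sqrt]; simp
  rw [chord]
  simp only [lift_coe, wedge, mul_one, one_mul]
  exact div_le_self (norm_nonneg _) (one_le_mul_of_one_le_of_one_le (h z) (h w))

theorem chord_coe_infty (z : ℂ) : chord z ∞ = 1 / nrm (z, 1) := by
  simp [chord, wedge, nrm]

theorem tendsto_chord_nhds (p : Sphere) : Tendsto (fun q => chord q p) (𝓝 p) (𝓝 0) := by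
  cases p using OnePoint.rec with
  | infty =>
    have : ContinuousAt (fun q => chord q ∞) ∞ := by
      rw [OnePoint.continuousAt_infty', chord_self]
      simp only [coclosedCompact_eq_cocompact]
      have h1 : Tendsto (fun z : ℂ => 1 / ‖z‖) (cocompact ℂ) (𝓝 0) := by
        simp only [one_div]
        exact (tendsto_norm_cocompact_atTop (E := ℂ)).inv_tendsto_atTop
      refine squeeze_zero' (Eventually.of_forall fun z => chord_nonneg _ _) ?_ h1
      filter_upwards [(tendsto_norm_cocompact_atTop (E := ℂ)).eventually_gt_atTop 0] with z hz
      simp only [Function.comp]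
      rw [chord_coe_infty]
      gcongr
      rw [nrm]
      apply Real.le_sqrt_of_sq_le
      simp
    simpa [ContinuousAt, chord_self] using this
  | coe w =>
    have : ContinuousAt (fun q => chord q w) (w : Sphere) := by
      rw [OnePoint.continuousAt_coe, ContinuousAt]
      simp only [Function.comp, chord_self]
      refine squeeze_zero (fun z => chord_nonneg _ _) (fun z => chord_coe_coe_le z w) ?_
      have : Tendsto (fun z : ℂ => ‖z - w‖) (𝓝 w) (𝓝 ‖w - w‖) := by
        apply Continuous.tendsto; fun_prop
      simpa using this
    simpa [ContinuousAt, chord_self] using this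

/-! ### The chordal metric induces the topology of the one-point compactification -/

theorem t2Space_of_metricSpace (X : Type*) [MetricSpace X] : T2Space X := inferInstance

/-- The chordal metric space structure, with its own topology. -/
abbrev chordMetricAux : MetricSpace Sphere where
  dist := chord
  dist_self := chord_self
  dist_comm := chord_comm
  dist_triangle := chord_triangle
  eq_of_dist_eq_zero := eq_of_chord_eq_zero

/-- The identity is a continuous bijection from a compact space to a Hausdorff one. -/
theorem topology_eq_chordMetricAux :
    (inferInstance : TopologicalSpace Sphere) =
      chordMetricAux.toUniformSpace.toTopologicalSpace := by
  have hc : @Continuous Sphere Sphere inferInstance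
      chordMetricAux.toUniformSpace.toTopologicalSpace id := by
    refine (@continuous_iff_continuousAt _ _ _
      chordMetricAux.toUniformSpace.toTopologicalSpace _).2 fun p => ?_
    exact (@tendsto_iff_dist_tendsto_zero _ _ chordMetricAux.toPseudoMetricSpace _ _ _).2
      (tendsto_chord_nhds p)
  have ht2 : @T2Space Sphere chordMetricAux.toUniformSpace.toTopologicalSpace :=
    @t2Space_of_metricSpace Sphere chordMetricAux
  apply le_antisymm
  · exact continuous_id_iff_le.1 hc
  · have := @Continuous.continuous_symm_of_equiv_compact_to_t2 Sphere Sphere inferInstance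
      chordMetricAux.toUniformSpace.toTopologicalSpace inferInstance
      ht2 (Equiv.refl _) hc
    exact continuous_id_iff_le.1 this

/-- The chordal metric space structure, compatible with the one-point compactification. -/
abbrev chordMetric : MetricSpace Sphere :=
  chordMetricAux.replaceTopology topology_eq_chordMetricAux

section Metric

attribute [local instance] chordMetric

/-- The inversion `z ↦ 1 / z`. -/
def inversion (p : Sphere) : Sphere := proj (lift p).swap

theorem swap_ne_zero {u : ℂ × ℂ} (hu : u ≠ 0) : u.swap ≠ 0 := by
  contrapose! hu; simpa using congrArg Prod.swap hu

theorem inversion_proj {u : ℂ × ℂ} (hu : u ≠ 0) : inversion (proj u) = proj u.swap := by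
  obtain ⟨c, hc, h⟩ := exists_lift_proj hu
  rw [inversion, h, show (c • u).swap = c • u.swap from rfl, proj_smul hc]

theorem inversion_inversion (p : Sphere) : inversion (inversion p) = p := by
  rw [inversion.eq_def p, inversion_proj (swap_ne_zero (lift_ne_zero p)), Prod.swap_swap, proj_lift]

theorem chord_inversion (p q : Sphere) : chord (inversion p) (inversion q) = chord p q := by
  rw [inversion, inversion, chord_proj (swap_ne_zero (lift_ne_zero p))
    (swap_ne_zero (lift_ne_zero q)), chord, wedge_swap, norm_neg]
  simp only [wedge, nrm, Prod.fst_swap, Prod.snd_swap, add_comm, mul_comm]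

/-- The inversion as an isometry. -/
def inversionIsometry : Sphere ≃ᵢ Sphere where
  toFun := inversion
  invFun := inversion
  left_inv := inversion_inversion
  right_inv := inversion_inversion
  isometry_toFun := Isometry.of_dist_eq chord_inversion

end Metric

/-! ### Montel's theorem -/

/-- A map on a convex set that is infinitesimally `C`-Lipschitz is `C`-Lipschitz. -/
theorem dist_le_of_eventually_dist_le {X : Type*} [PseudoMetricSpace X] {γ : ℂ → X} {s : Set ℂ}
    (hs : Convex ℝ s) {C : ℝ}
    (h : ∀ z ∈ s, ∀ᶠ w in 𝓝 z, dist (γ w) (γ z) ≤ C * ‖w - z‖) {z w : ℂ} (hz : z ∈ s)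
    (hw : w ∈ s) : dist (γ w) (γ z) ≤ C * ‖w - z‖ := by
  rcases eq_or_ne w z with rfl | hne
  · simp
  have hL : 0 < ‖w - z‖ := norm_pos_iff.2 (sub_ne_zero.2 hne)
  have hcont : ∀ z ∈ s, ContinuousAt γ z := fun z hz => by
    rw [ContinuousAt, tendsto_iff_dist_tendsto_zero]
    refine squeeze_zero' (Eventually.of_forall fun _ => dist_nonneg) (h z hz) ?_
    have : Tendsto (fun w : ℂ => C * ‖w - z‖) (𝓝 z) (𝓝 (C * ‖z - z‖)) := by
      apply Continuous.tendsto; fun_prop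
    simpa using this
  set p : ℝ → ℂ := fun t => z + t * (w - z) with hp
  have hpc : Continuous p := by fun_prop
  have hps : ∀ t ∈ Icc (0 : ℝ) 1, p t ∈ s := fun t ht => by
    have := hs.add_smul_sub_mem hz hw ht
    simpa [hp] using this
  -- The comparison theorem needs a strict inequality of slopes, hence the slack from `C * ‖w - z‖`
  -- to `D`.
  refine le_of_forall_gt_imp_ge_of_dense fun D hD => ?_
  have key := image_le_of_liminf_slope_right_lt_deriv_boundary'
    (f := fun t => dist (γ (p t)) (γ z)) (f' := fun _ => C * ‖w - z‖) (a := 0) (b := 1)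
    (B := fun t => D * t) (B' := fun _ => D)
    (fun t ht => ContinuousAt.continuousWithinAt (Filter.Tendsto.dist
      ((hcont _ (hps t ht)).tendsto.comp (hpc.tendsto t)) tendsto_const_nhds))
    (fun t ht r hr => ?_) (by simp [hp]) (by fun_prop)
    (fun t _ => by simpa using ((hasDerivAt_id t).const_mul D).hasDerivWithinAt)
    (fun _ _ _ => hD) (show (1 : ℝ) ∈ Icc (0 : ℝ) 1 by simp)
  · simpa [hp] using key
  · have h1 := (hpc.tendsto t).eventually (h (p t) (hps t (Ico_subset_Icc_self ht)))
    refine Eventually.frequently ?_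
    filter_upwards [h1.filter_mono nhdsWithin_le_nhds, self_mem_nhdsWithin] with u hu hut
    have hut : 0 < u - t := sub_pos.2 hut
    refine lt_of_le_of_lt ?_ hr
    rw [slope_def_field, div_le_iff₀ hut]
    have e : p u - p t = ((u - t : ℝ) : ℂ) * (w - z) := by simp only [hp]; push_cast; ring
    rw [e, norm_mul, Complex.norm_real, Real.norm_of_nonneg hut.le] at hu
    have := dist_triangle (γ (p u)) (γ (p t)) (γ z)
    linarith

/-! ### The second-order condition at a maximum, without Laplacians -/

theorem one_add_sq_mul_one_add_sq (z w : ℂ) :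
    (1 + ‖z‖ ^ 2) * (1 + ‖w‖ ^ 2) = ‖1 + starRingEnd ℂ w * z‖ ^ 2 + ‖z - w‖ ^ 2 := by
  simp only [← Complex.normSq_eq_norm_sq, Complex.normSq_apply]
  simp
  ring

theorem sub_sq_mul_sub_sq (r : ℝ) (z w : ℂ) :
    (r ^ 2 - ‖z‖ ^ 2) * (r ^ 2 - ‖w‖ ^ 2) =
      ‖(r : ℂ) ^ 2 - starRingEnd ℂ w * z‖ ^ 2 - r ^ 2 * ‖z - w‖ ^ 2 := by
  simp only [← Complex.normSq_eq_norm_sq, Complex.normSq_apply]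
  simp [← Complex.ofReal_pow]
  ring

/-- Maximum modulus principle: otherwise $|H|$ has a strict local maximum at $c$, although $H$ must
then be locally constant. -/
theorem frequently_norm_le {H : ℂ → ℂ} {c : ℂ} (hH : AnalyticAt ℂ H c) :
    ∃ᶠ z in 𝓝[≠] c, ‖H c‖ ≤ ‖H z‖ := by
  intro hlt
  simp only [not_le] at hlt
  have hmax : IsLocalMax (norm ∘ H) c := by
    rw [eventually_nhdsWithin_iff] at hlt
    filter_upwards [hlt] with z hz
    rcases eq_or_ne z c with rfl | hne
    · exact le_rfl
    · exact (hz hne).le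
  have hconst := Complex.eventually_eq_of_isLocalMax_norm
    (hH.eventually_analyticAt.mono fun z hz => hz.differentiableAt) hmax
  obtain ⟨z, hz1, hz2⟩ := (hlt.and (hconst.filter_mono nhdsWithin_le_nhds)).exists
  rw [hz2] at hz1
  exact lt_irrefl _ hz1

theorem tendsto_slope_sq_div {h : ℂ → ℂ} {c : ℂ} (hh : AnalyticAt ℂ h c) :
    Tendsto (fun z => ‖slope h c z‖ ^ 2 / ‖1 + starRingEnd ℂ (h c) * h z‖ ^ 2) (𝓝[≠] c)
      (𝓝 (‖deriv h c‖ ^ 2 / (1 + ‖h c‖ ^ 2) ^ 2)) := by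
  have h0 : ‖1 + starRingEnd ℂ (h c) * h c‖ = 1 + ‖h c‖ ^ 2 := by
    rw [Complex.conj_mul', ← Complex.ofReal_pow, ← Complex.ofReal_one, ← Complex.ofReal_add,
      Complex.norm_real, Real.norm_of_nonneg (by positivity)]
  have h1 : Tendsto (fun z => ‖1 + starRingEnd ℂ (h c) * h z‖) (𝓝[≠] c) (𝓝 (1 + ‖h c‖ ^ 2)) := by
    rw [← h0]
    exact ((continuousAt_const.add (continuousAt_const.mul hh.continuousAt)).norm.tendsto).mono_left
      nhdsWithin_le_nhds
  exact ((hasDerivAt_iff_tendsto_slope.1 hh.differentiableAt.hasDerivAt).norm.pow 2).div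
    (h1.pow 2) (by positivity)

/-- Division by $gABS^2$ gives $(1+xt)(1+yt)(1-wt)^2\le 1$. Its first-order part in $t$ is $x+y\le
2w$, up to an error that vanishes with $t$. -/
theorem add_le_of_mul_le_mul {g A B S x y w t : ℝ} (hg : 0 < g) (hA : 0 < A) (hB : 0 < B)
    (hS : 0 < S) (ht : 0 < t) (hx : 0 ≤ x) (hy : 0 ≤ y)
    (h : g * ((A + x * t * A) * (B + y * t * B) * (S - w * S * t) ^ 2) ≤ g * A * B * S ^ 2) :
    x + y ≤ 2 * w * (1 + (x + y) * t) := by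
  have h5 : (1 + x * t) * (1 + y * t) * (1 - w * t) ^ 2 ≤ 1 := by
    have hpos : 0 < g * A * B * S ^ 2 := by positivity
    refine le_of_mul_le_mul_left ?_ hpos
    calc _ = g * ((A + x * t * A) * (B + y * t * B) * (S - w * S * t) ^ 2) := by ring
      _ ≤ _ := h
      _ = _ := by ring
  have h6 : (1 + (x + y) * t) * (1 - 2 * (w * t)) ≤ 1 := by
    refine le_trans ?_ h5
    have h7 : 1 + (x + y) * t ≤ (1 + x * t) * (1 + y * t) := by
      have : 0 ≤ x * t * (y * t) := by positivity
      linarith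
    have h8 : 0 ≤ 1 + (x + y) * t := by positivity
    calc _ ≤ (1 + (x + y) * t) * (1 - w * t) ^ 2 := by
          gcongr
          linarith [sq_nonneg (w * t)]
      _ ≤ _ := by gcongr
  have h9 : (x + y) * t ≤ 2 * w * (1 + (x + y) * t) * t := by linarith
  exact le_of_mul_le_mul_right h9 ht

/-- The second-order condition at a local maximum, in the form that the logarithm of the product
has nonpositive Laplacian. -/
theorem sq_deriv_le_of_eventually_le {h k G : ℂ → ℂ} {c : ℂ} {r : ℝ} (hh : AnalyticAt ℂ h c)
    (hk : AnalyticAt ℂ k c) (hG : AnalyticAt ℂ G c) (hG0 : G c ≠ 0) (hr : ‖c‖ < r)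
    (hmax : ∀ᶠ z in 𝓝 c,
      (1 + ‖h z‖ ^ 2) * (1 + ‖k z‖ ^ 2) * ‖G z‖ ^ 2 * (r ^ 2 - ‖z‖ ^ 2) ^ 2 ≤
        (1 + ‖h c‖ ^ 2) * (1 + ‖k c‖ ^ 2) * ‖G c‖ ^ 2 * (r ^ 2 - ‖c‖ ^ 2) ^ 2) :
    ‖deriv h c‖ ^ 2 / (1 + ‖h c‖ ^ 2) ^ 2 + ‖deriv k c‖ ^ 2 / (1 + ‖k c‖ ^ 2) ^ 2 ≤
      2 * (r ^ 2 / (r ^ 2 - ‖c‖ ^ 2) ^ 2) := by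
  have hr0 : 0 < r ^ 2 - ‖c‖ ^ 2 := by nlinarith [norm_nonneg c]
  -- Polarisation at $c$: up to constants, each real factor is the squared modulus of one of the
  -- holomorphic functions $a$, $b$, $s$, plus or minus a term of order $|z-c|^2$.
  set a : ℂ → ℂ := fun z => 1 + starRingEnd ℂ (h c) * h z with ha
  set b : ℂ → ℂ := fun z => 1 + starRingEnd ℂ (k c) * k z with hb
  set s : ℂ → ℂ := fun z => (r : ℂ) ^ 2 - starRingEnd ℂ c * z with hs
  have haA : AnalyticAt ℂ a c := analyticAt_const.add (analyticAt_const.mul hh)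
  have hbA : AnalyticAt ℂ b c := analyticAt_const.add (analyticAt_const.mul hk)
  have hsA : AnalyticAt ℂ s c := analyticAt_const.sub (analyticAt_const.mul analyticAt_id)
  have ida : ∀ z, (1 + ‖h z‖ ^ 2) * (1 + ‖h c‖ ^ 2) = ‖a z‖ ^ 2 + ‖h z - h c‖ ^ 2 :=
    fun z => one_add_sq_mul_one_add_sq _ _
  have idb : ∀ z, (1 + ‖k z‖ ^ 2) * (1 + ‖k c‖ ^ 2) = ‖b z‖ ^ 2 + ‖k z - k c‖ ^ 2 :=
    fun z => one_add_sq_mul_one_add_sq _ _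
  have ids : ∀ z, (r ^ 2 - ‖z‖ ^ 2) * (r ^ 2 - ‖c‖ ^ 2) = ‖s z‖ ^ 2 - r ^ 2 * ‖z - c‖ ^ 2 :=
    fun z => sub_sq_mul_sub_sq _ _ _
  have hac : ‖a c‖ ^ 2 = (1 + ‖h c‖ ^ 2) * (1 + ‖h c‖ ^ 2) := by rw [ida]; simp
  have hbc : ‖b c‖ ^ 2 = (1 + ‖k c‖ ^ 2) * (1 + ‖k c‖ ^ 2) := by rw [idb]; simp
  have hsc : ‖s c‖ ^ 2 = (r ^ 2 - ‖c‖ ^ 2) * (r ^ 2 - ‖c‖ ^ 2) := by rw [ids]; simp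
  -- At points arbitrarily near $c$ the holomorphic part $Gabs^2$ is no smaller than at $c$. There,
  -- maximality constrains only the terms in $|z-c|^2$.
  have hfreq := frequently_norm_le (((hG.mul haA).mul hbA).mul (hsA.pow 2))
  have hT1 := tendsto_slope_sq_div hh
  have hT2 := tendsto_slope_sq_div hk
  have hT3 : Tendsto (fun z => r ^ 2 / ‖s z‖ ^ 2) (𝓝[≠] c)
      (𝓝 (r ^ 2 / (r ^ 2 - ‖c‖ ^ 2) ^ 2)) := by
    rw [sq (r ^ 2 - ‖c‖ ^ 2), ← hsc]
    refine tendsto_const_nhds.div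
      ((hsA.continuousAt.norm.pow 2).tendsto.mono_left nhdsWithin_le_nhds) ?_
    rw [hsc]; positivity
  have hT4 : Tendsto (fun z => ‖z - c‖ ^ 2) (𝓝[≠] c) (𝓝 0) := by
    have : Tendsto (fun z => ‖z - c‖ ^ 2) (𝓝 c) (𝓝 (‖c - c‖ ^ 2)) := by
      apply Continuous.tendsto; fun_prop
    simpa using this.mono_left nhdsWithin_le_nhds
  have hT5 := (hT3.const_mul 2).mul (((hT1.add hT2).mul hT4).const_add 1)
  rw [mul_zero, add_zero, mul_one] at hT5
  by_contra! hcon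
  have hev := hT5.eventually_lt (hT1.add hT2) hcon
  obtain ⟨z, hz1, hz2, hz3, hz4⟩ := (hfreq.and_eventually (hev.and
    ((hmax.filter_mono nhdsWithin_le_nhds).and self_mem_nhdsWithin))).exists
  have hzc : 0 < ‖z - c‖ := norm_pos_iff.2 (sub_ne_zero.2 hz4)
  simp only [Pi.mul_apply, Pi.pow_apply, norm_mul, norm_pow] at hz1
  have hsl : ∀ g : ℂ → ℂ, ‖g z - g c‖ ^ 2 = ‖slope g c z‖ ^ 2 * ‖z - c‖ ^ 2 := fun g => by
    rw [slope_def_field, norm_div, div_pow, div_mul_cancel₀]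
    positivity
  have hGc : 0 < ‖G c‖ := norm_pos_iff.2 hG0
  have pos_of : ∀ (u : ℂ) (v : ℝ), 0 < v → ‖u‖ ^ 2 = v * v → 0 < ‖u‖ := fun u v hv h =>
    norm_pos_iff.2 (by rintro rfl; simp at h; linarith)
  have hac0 := pos_of _ _ (by positivity) hac
  have hbc0 := pos_of _ _ (by positivity) hbc
  have hsc0 := pos_of _ _ hr0 hsc
  have hprod : 0 < ‖G z‖ * ‖a z‖ * ‖b z‖ * ‖s z‖ ^ 2 := lt_of_lt_of_le (by positivity) hz1
  have hGz : 0 < ‖G z‖ := (norm_nonneg _).lt_of_ne' fun h0 => by simp [h0] at hprod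
  have haz : 0 < ‖a z‖ := (norm_nonneg _).lt_of_ne' fun h0 => by simp [h0] at hprod
  have hbz : 0 < ‖b z‖ := (norm_nonneg _).lt_of_ne' fun h0 => by simp [h0] at hprod
  have hsz : 0 < ‖s z‖ := (norm_nonneg _).lt_of_ne' fun h0 => by simp [h0] at hprod
  have hsq := pow_le_pow_left₀ (by positivity) hz1 2
  have e1 : (‖G c‖ * ‖a c‖ * ‖b c‖ * ‖s c‖ ^ 2) ^ 2 =
      ((1 + ‖h c‖ ^ 2) * (1 + ‖k c‖ ^ 2) * ‖G c‖ ^ 2 * (r ^ 2 - ‖c‖ ^ 2) ^ 2) *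
        ((1 + ‖h c‖ ^ 2) * (1 + ‖k c‖ ^ 2) * (r ^ 2 - ‖c‖ ^ 2) ^ 2) := by
    rw [show (‖G c‖ * ‖a c‖ * ‖b c‖ * ‖s c‖ ^ 2) ^ 2 =
      ‖G c‖ ^ 2 * ‖a c‖ ^ 2 * ‖b c‖ ^ 2 * (‖s c‖ ^ 2) ^ 2 by ring, hac, hbc, hsc]
    ring
  have e2 : ((1 + ‖h z‖ ^ 2) * (1 + ‖k z‖ ^ 2) * ‖G z‖ ^ 2 * (r ^ 2 - ‖z‖ ^ 2) ^ 2) *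
        ((1 + ‖h c‖ ^ 2) * (1 + ‖k c‖ ^ 2) * (r ^ 2 - ‖c‖ ^ 2) ^ 2) =
      ‖G z‖ ^ 2 * ((‖a z‖ ^ 2 + ‖h z - h c‖ ^ 2) * (‖b z‖ ^ 2 + ‖k z - k c‖ ^ 2) *
        (‖s z‖ ^ 2 - r ^ 2 * ‖z - c‖ ^ 2) ^ 2) := by
    rw [← ida, ← idb, ← ids]; ring
  have h3 := mul_le_mul_of_nonneg_right hz3 (by positivity :
    0 ≤ (1 + ‖h c‖ ^ 2) * (1 + ‖k c‖ ^ 2) * (r ^ 2 - ‖c‖ ^ 2) ^ 2)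
  rw [e2, ← e1] at h3
  have h4 := h3.trans hsq
  set x := ‖slope h c z‖ ^ 2 / ‖a z‖ ^ 2 with hx
  set y := ‖slope k c z‖ ^ 2 / ‖b z‖ ^ 2 with hy
  set w := r ^ 2 / ‖s z‖ ^ 2 with hw
  have hX : ‖h z - h c‖ ^ 2 = x * ‖z - c‖ ^ 2 * ‖a z‖ ^ 2 := by
    rw [hsl, hx]; field_simp
  have hY : ‖k z - k c‖ ^ 2 = y * ‖z - c‖ ^ 2 * ‖b z‖ ^ 2 := by
    rw [hsl, hy]; field_simp
  have hW : r ^ 2 = w * ‖s z‖ ^ 2 := by rw [hw]; field_simp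
  rw [hX, hY, hW] at h4
  refine absurd (add_le_of_mul_le_mul (x := x) (y := y) (w := w) (t := ‖z - c‖ ^ 2)
    (pow_pos hGz 2) (pow_pos haz 2) (pow_pos hbz 2) (pow_pos hsz 2) (pow_pos hzc 2)
    (by positivity) (by positivity) (h4.trans_eq (by ring))) (not_le.2 hz2)

/-! ### Sixth roots and the Ahlfors–Schwarz estimate -/

theorem exists_pow_six_eq {f : ℂ → ℂ} {c : ℂ} {R : ℝ} (hf : DifferentiableOn ℂ f (ball c R))
    (h0 : ∀ z ∈ ball c R, f z ≠ 0) :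
    ∃ h : ℂ → ℂ, DifferentiableOn ℂ h (ball c R) ∧ ∀ z ∈ ball c R, h z ^ 6 = f z := by
  rcases le_or_gt R 0 with hR | hR
  · exact ⟨0, by simp [ball_eq_empty.2 hR], by simp [ball_eq_empty.2 hR]⟩
  have hd : DifferentiableOn ℂ (fun z => deriv f z / f z) (ball c R) :=
    (hf.deriv isOpen_ball).div hf h0
  obtain ⟨g, hgc, hg⟩ := hd.isExactOn_ball.with_val_at c (Complex.log (f c))
  have hfd : ∀ z ∈ ball c R, HasDerivAt f (deriv f z) z := fun z hz =>
    (hf.differentiableAt (isOpen_ball.mem_nhds hz)).hasDerivAt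
  have hprod : ∀ z ∈ ball c R, HasDerivAt (fun z => f z * Complex.exp (-g z)) 0 z := fun z hz => by
    have := (hfd z hz).mul ((hg z hz).neg.cexp)
    refine this.congr_deriv ?_
    have := h0 z hz
    field_simp
    ring
  have hconst : ∀ z ∈ ball c R, f z * Complex.exp (-g z) = 1 := fun z hz => by
    have h1 := isOpen_ball.is_const_of_deriv_eq_zero (convex_ball c R).isPreconnected
      (f := fun z => f z * Complex.exp (-g z))
      (fun z hz => (hprod z hz).differentiableAt.differentiableWithinAt)
      (fun z hz => (hprod z hz).deriv) hz (mem_ball_self hR)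
    rw [h1, hgc, Complex.exp_neg, Complex.exp_log (h0 c (mem_ball_self hR)),
      mul_inv_cancel₀ (h0 c (mem_ball_self hR))]
  refine ⟨fun z => Complex.exp (g z / 6), fun z hz => ?_, fun z hz => ?_⟩
  · exact ((hg z hz).differentiableAt.div_const 6).cexp.differentiableWithinAt
  · rw [← Complex.exp_nat_mul]
    have := hconst z hz
    rw [Complex.exp_neg, mul_inv_eq_one₀ (Complex.exp_ne_zero _)] at this
    rw [this]; congr 1; push_cast; ring

theorem one_add_pow_four_le {b : ℝ} (hb : 1 / 2 ≤ b) : (1 + b) ^ 2 / 162 ≤ b ^ 5 / (1 + b) ^ 2 := by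
  have h1 : (1 + b) ^ 4 ≤ (3 * b) ^ 4 := by gcongr; linarith
  have h2 : 0 ≤ b ^ 4 := by positivity
  rw [div_le_div_iff₀ (by norm_num) (by positivity)]
  calc (1 + b) ^ 2 * (1 + b) ^ 2 = (1 + b) ^ 4 := by ring
    _ ≤ (3 * b) ^ 4 := h1
    _ ≤ b ^ 5 * 162 := by nlinarith

/-- If $b<1/2$ then $a^3+b^3\le 1/4$. Otherwise $1+b\le 3b$ and $(1+b)^4\le 81b^4\le 162b^5$, which
is the source of 162. -/
theorem curvature_bound_aux {a b : ℝ} (ha : 0 ≤ a) (hab : a ≤ b) (h : 1 ≤ a ^ 3 + b ^ 3) :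
    (1 + a) * (1 + b) / 162 ≤ b ^ 5 / (1 + a) ^ 2 + a ^ 5 / (1 + b) ^ 2 := by
  have hb0 : 0 ≤ b := ha.trans hab
  have hb : 1 / 2 ≤ b := by
    by_contra! hlt
    have h1 : b ^ 3 ≤ (1 / 2) ^ 3 := by gcongr
    have h2 : a ^ 3 ≤ (1 / 2) ^ 3 := by gcongr; linarith
    norm_num at h1 h2
    linarith
  calc (1 + a) * (1 + b) / 162 ≤ (1 + b) ^ 2 / 162 := by gcongr; nlinarith
    _ ≤ b ^ 5 / (1 + b) ^ 2 := one_add_pow_four_le hb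
    _ ≤ b ^ 5 / (1 + a) ^ 2 := by gcongr
    _ ≤ _ := le_add_of_nonneg_right (by positivity)

/-- Negative curvature: up to $|G|^2$ and constants, the left side is the squared density of the
metric and the right side the Laplacian of its logarithm. -/
theorem curvature_bound {a b : ℝ} (ha : 0 ≤ a) (hb : 0 ≤ b) (h : 1 ≤ a ^ 3 + b ^ 3) :
    (1 + a) * (1 + b) / 162 ≤ b ^ 5 / (1 + a) ^ 2 + a ^ 5 / (1 + b) ^ 2 := by
  rcases le_total a b with hab | hab
  · exact curvature_bound_aux ha hab h
  · rw [add_comm (b ^ 5 / _), mul_comm (1 + a)]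
    exact curvature_bound_aux hb hab (by linarith)

/-- With $a=|f|^{1/3}$ and $b=|f-1|^{1/3}$, this says that the Ahlfors metric dominates the
spherical one. -/
theorem pow_five_mul_pow_five_le {a b : ℝ} (ha : 0 ≤ a) (hb : 0 ≤ b) (h : b ^ 3 ≤ 1 + a ^ 3) :
    a ^ 5 * b ^ 5 ≤ 16 * (1 + a ^ 6) ^ 2 * ((1 + a) * (1 + b)) := by
  have hba : b ≤ 1 + a := by
    by_contra! hlt
    have : (1 + a) ^ 3 < b ^ 3 := by gcongr
    nlinarith [mul_nonneg ha ha]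
  have h1 : a ^ 4 * b ^ 4 ≤ 16 * (1 + a ^ 6) ^ 2 := by
    calc a ^ 4 * b ^ 4 ≤ a ^ 4 * (1 + a) ^ 4 := by gcongr
      _ = (a * (1 + a)) ^ 4 := by ring
      _ ≤ 16 * (1 + a ^ 6) ^ 2 := by
        rcases le_total a 1 with h1 | h1
        · have : (a * (1 + a)) ^ 4 ≤ (1 * (1 + 1)) ^ 4 := by gcongr
          have h6 : 1 ≤ (1 + a ^ 6) ^ 2 := one_le_pow₀ (by linarith [pow_nonneg ha 6])
          linarith
        · have : (a * (1 + a)) ^ 4 ≤ (a * (a + a)) ^ 4 := by gcongr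
          have h8 : a ^ 8 ≤ a ^ 12 := pow_le_pow_right₀ h1 (by norm_num)
          nlinarith [pow_nonneg ha 6]
  calc a ^ 5 * b ^ 5 = a ^ 4 * b ^ 4 * (a * b) := by ring
    _ ≤ _ := by gcongr <;> linarith

/-- The Ahlfors–Schwarz estimate for the curvature metric of the twice-punctured plane, in terms
of the uniformising coordinates `h ^ 6 = f` and `k ^ 6 = f - 1`. -/
theorem ahlfors_schwarz {h k : ℂ → ℂ} {r : ℝ} (hr : 0 < r)
    (hh : AnalyticOnNhd ℂ h (closedBall 0 r)) (hk : AnalyticOnNhd ℂ k (closedBall 0 r))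
    (hh0 : ∀ z ∈ closedBall (0 : ℂ) r, h z ≠ 0) (hk0 : ∀ z ∈ closedBall (0 : ℂ) r, k z ≠ 0)
    (hhk : ∀ z ∈ closedBall (0 : ℂ) r, h z ^ 6 = k z ^ 6 + 1)
    (hder : ∀ z ∈ ball (0 : ℂ) r, h z ^ 5 * deriv h z = k z ^ 5 * deriv k z) {z : ℂ}
    (hz : z ∈ closedBall (0 : ℂ) r) :
    (1 + ‖h z‖ ^ 2) * (1 + ‖k z‖ ^ 2) * ‖deriv h z / k z ^ 5‖ ^ 2 * (r ^ 2 - ‖z‖ ^ 2) ^ 2 ≤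
      324 * r ^ 2 := by
  -- With $f=h^6$, $G=f'/(6h^5k^5)$. The first three factors of $v$ are the squared density of the
  -- pulled-back metric; the last is the inverse of the hyperbolic one, up to $r^2$.
  set G : ℂ → ℂ := fun z => deriv h z / k z ^ 5 with hGdef
  have hG : AnalyticOnNhd ℂ G (closedBall 0 r) := fun z hz =>
    (hh z hz).deriv.div ((hk z hz).pow 5) (pow_ne_zero 5 (hk0 z hz))
  set v : ℂ → ℝ := fun z =>
    (1 + ‖h z‖ ^ 2) * (1 + ‖k z‖ ^ 2) * ‖G z‖ ^ 2 * (r ^ 2 - ‖z‖ ^ 2) ^ 2 with hv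
  have hvc : ContinuousOn v (closedBall 0 r) := by
    have h1 := hh.continuousOn
    have h2 := hk.continuousOn
    have h3 := hG.continuousOn
    fun_prop
  obtain ⟨c, hc, hmax⟩ := (isCompact_closedBall (0 : ℂ) r).exists_isMaxOn ⟨z, hz⟩ hvc
  refine (hmax hz).trans ?_
  change v c ≤ _
  have hcr : ‖c‖ ≤ r := by simpa using hc
  by_cases hG0 : G c = 0
  · simp [hv, hG0]; positivity
  rcases hcr.eq_or_lt with hcr | hcr
  · simp [hv, hcr]; positivity
  have hcb : c ∈ ball (0 : ℂ) r := by simpa using hcr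
  have hk0c := hk0 c hc
  have hh0c := hh0 c hc
  have key := sq_deriv_le_of_eventually_le (hh c hc) (hk c hc) (hG c hc) hG0 hcr
    (by filter_upwards [isOpen_ball.mem_nhds hcb] with w hw
        exact hmax (ball_subset_closedBall hw))
  have hdh : deriv h c = G c * k c ^ 5 := by simp only [hGdef]; field_simp
  have hdk : deriv k c = G c * h c ^ 5 := by
    have := hder c hcb
    rw [hdh] at this
    have h5 : k c ^ 5 ≠ 0 := pow_ne_zero 5 hk0c
    apply mul_left_cancel₀ h5
    rw [← this]; ring
  set a := ‖h c‖ ^ 2 with ha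
  set b := ‖k c‖ ^ 2 with hb
  have ea : ‖deriv k c‖ ^ 2 = ‖G c‖ ^ 2 * a ^ 5 := by
    rw [hdk, norm_mul, norm_pow, ha]; ring
  have eb : ‖deriv h c‖ ^ 2 = ‖G c‖ ^ 2 * b ^ 5 := by
    rw [hdh, norm_mul, norm_pow, hb]; ring
  rw [ea, eb] at key
  have h1 : 1 ≤ a ^ 3 + b ^ 3 := by
    have e := hhk c hc
    have e1 : h c ^ 6 + -(k c ^ 6) = 1 := by rw [e]; ring
    have := norm_add_le (h c ^ 6) (-(k c ^ 6))
    rw [e1, norm_one, norm_neg, norm_pow, norm_pow] at this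
    rw [ha, hb, ← pow_mul, ← pow_mul]
    exact this
  have h2 := curvature_bound (by positivity) (by positivity) h1
  have hpos : 0 < r ^ 2 - ‖c‖ ^ 2 := by nlinarith [norm_nonneg c]
  have h3 : ‖G c‖ ^ 2 * ((1 + a) * (1 + b) / 162) ≤ 2 * (r ^ 2 / (r ^ 2 - ‖c‖ ^ 2) ^ 2) := by
    refine le_trans ?_ key
    calc _ ≤ ‖G c‖ ^ 2 * (b ^ 5 / (1 + a) ^ 2 + a ^ 5 / (1 + b) ^ 2) := by gcongr
      _ = _ := by ring
  rw [← mul_div_assoc 2, le_div_iff₀ (by positivity)] at h3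
  simp only [hv]
  rw [← ha, ← hb]
  linarith

/-! ### From the derivative bound to Lipschitz estimates -/

theorem chord_coe_coe (z w : ℂ) : chord z w = ‖z - w‖ / (nrm (z, 1) * nrm (w, 1)) := by
  simp [chord, wedge]

theorem eventually_chord_le_of_deriv_lt {f : ℂ → ℂ} {z : ℂ} (hf : DifferentiableAt ℂ f z) {C : ℝ}
    (hC : ‖deriv f z‖ / (1 + ‖f z‖ ^ 2) < C) :
    ∀ᶠ w in 𝓝 z, chord (f w) (f z) ≤ C * ‖w - z‖ := by
  have hn : ∀ u : ℂ, 0 < nrm (u, 1) := fun u => nrm_pos (by simp [Prod.ext_iff])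
  have hcn : Continuous fun u : ℂ => nrm (u, 1) := by unfold nrm; fun_prop
  have h1 : Tendsto (fun w => ‖slope f z w‖ / (nrm (f w, 1) * nrm (f z, 1))) (𝓝[≠] z)
      (𝓝 (‖deriv f z‖ / (nrm (f z, 1) * nrm (f z, 1)))) := by
    refine (hasDerivAt_iff_tendsto_slope.1 hf.hasDerivAt).norm.div ?_
      (mul_pos (hn _) (hn _)).ne'
    exact (((hcn.tendsto _).comp hf.continuousAt.tendsto).mono_left
      nhdsWithin_le_nhds).mul_const _
  have e : nrm (f z, 1) * nrm (f z, 1) = 1 + ‖f z‖ ^ 2 := by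
    rw [← sq, nrm_sq]; simp [add_comm]
  rw [e] at h1
  have h2 := h1.eventually_lt_const hC
  rw [eventually_nhdsWithin_iff] at h2
  filter_upwards [h2] with w hw
  rcases eq_or_ne w z with rfl | hne
  · simp [chord_self]
  · have h3 := (hw hne).le
    have h4 : 0 < ‖w - z‖ := norm_pos_iff.2 (sub_ne_zero.2 hne)
    rw [slope_def_field, norm_div, div_div, mul_comm ‖w - z‖, ← div_div, ← chord_coe_coe,
      div_le_iff₀ h4] at h3
    exact h3

section Metric

attribute [local instance] chordMetric

/-- A holomorphic function on a disc omitting `0` and `1` is Lipschitz on the half disc for the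
chordal metric, with a constant depending only on the radius. -/
theorem chord_le_of_omits_zero_one {f : ℂ → ℂ} {R : ℝ} (hR : 0 < R)
    (hf : DifferentiableOn ℂ f (ball 0 R)) (h0 : ∀ z ∈ ball (0 : ℂ) R, f z ≠ 0)
    (h1 : ∀ z ∈ ball (0 : ℂ) R, f z ≠ 1) {z w : ℂ} (hz : z ∈ ball (0 : ℂ) (R / 2))
    (hw : w ∈ ball (0 : ℂ) (R / 2)) : chord (f w) (f z) ≤ 2000 / R * ‖w - z‖ := by
  obtain ⟨h, hhd, hh⟩ := exists_pow_six_eq hf h0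
  obtain ⟨k, hkd, hk⟩ := exists_pow_six_eq (f := fun z => f z - 1) (hf.sub_const 1)
    (fun z hz => sub_ne_zero.2 (h1 z hz))
  -- For $|z|<R/2$ this gives $r^2-|z|^2\ge\frac5{16}R^2$. The resulting constant is
  -- $432\cdot\frac34\cdot\frac{16}5=1036.8$, rounded up to 2000.
  set r := 3 / 4 * R with hr
  have hrR : closedBall (0 : ℂ) r ⊆ ball 0 R := closedBall_subset_ball (by linarith)
  have hh0 : ∀ z ∈ ball (0 : ℂ) R, h z ≠ 0 := fun z hz h' => h0 z hz (by rw [← hh z hz, h']; simp)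
  have hk0 : ∀ z ∈ ball (0 : ℂ) R, k z ≠ 0 := fun z hz h' =>
    sub_ne_zero.2 (h1 z hz) (by rw [← hk z hz, h']; simp)
  have hfd : ∀ z ∈ ball (0 : ℂ) R, DifferentiableAt ℂ f z := fun z hz =>
    hf.differentiableAt (isOpen_ball.mem_nhds hz)
  have dh : ∀ z ∈ ball (0 : ℂ) R, deriv f z = 6 * (h z ^ 5 * deriv h z) := fun z hz => by
    have e : f =ᶠ[𝓝 z] fun z => h z ^ 6 := by
      filter_upwards [isOpen_ball.mem_nhds hz] with w hw using (hh w hw).symm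
    rw [e.deriv_eq]
    have := ((hhd.differentiableAt (isOpen_ball.mem_nhds hz)).hasDerivAt.pow 6).deriv
    refine this.trans ?_
    norm_num; ring
  have dk : ∀ z ∈ ball (0 : ℂ) R, deriv f z = 6 * (k z ^ 5 * deriv k z) := fun z hz => by
    have e : f =ᶠ[𝓝 z] fun z => k z ^ 6 + 1 := by
      filter_upwards [isOpen_ball.mem_nhds hz] with w hw
      rw [hk w hw]; ring
    rw [e.deriv_eq]
    have := (((hkd.differentiableAt (isOpen_ball.mem_nhds hz)).hasDerivAt.pow 6).add_const 1).deriv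
    refine this.trans ?_
    norm_num; ring
  have key : ∀ z ∈ ball (0 : ℂ) (R / 2), ‖deriv f z‖ / (1 + ‖f z‖ ^ 2) < 2000 / R := by
    intro z hz
    have hzR : z ∈ ball (0 : ℂ) R := ball_subset_ball (by linarith) hz
    have hzr : z ∈ closedBall (0 : ℂ) r :=
      ball_subset_closedBall (ball_subset_ball (by linarith) hz)
    have hA := ahlfors_schwarz (r := r) (by positivity)
      ((hhd.analyticOnNhd isOpen_ball).mono hrR) ((hkd.analyticOnNhd isOpen_ball).mono hrR)
      (fun z hz => hh0 z (hrR hz)) (fun z hz => hk0 z (hrR hz))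
      (fun z hz => by rw [hh z (hrR hz), hk z (hrR hz)]; ring)
      (fun z hz => by
        have := (dh z (ball_subset_ball (by linarith) hz)).symm.trans
          (dk z (ball_subset_ball (by linarith) hz))
        exact mul_left_cancel₀ (by norm_num) this) hzr
    set a := ‖h z‖ ^ 2 with ha
    set b := ‖k z‖ ^ 2 with hb
    set g := ‖deriv h z / k z ^ 5‖ ^ 2 with hg
    have hb3 : b ^ 3 ≤ 1 + a ^ 3 := by
      have e : k z ^ 6 = h z ^ 6 - 1 := by rw [hh z hzR, hk z hzR]
      have := norm_sub_le (h z ^ 6) 1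
      rw [← e, norm_one, norm_pow, norm_pow] at this
      rw [ha, hb, ← pow_mul, ← pow_mul]
      norm_num
      linarith
    have hab := pow_five_mul_pow_five_le (by positivity) (by positivity) hb3
    have hf2 : ‖f z‖ ^ 2 = a ^ 6 := by rw [← hh z hzR, norm_pow, ha]; ring
    have hfd2 : ‖deriv f z‖ ^ 2 = 36 * (g * (a ^ 5 * b ^ 5)) := by
      have hkz := norm_pos_iff.2 (hk0 z hzR)
      rw [dh z hzR, norm_mul, norm_mul, norm_pow, hg, norm_div, norm_pow, ha, hb]
      field_simp
      norm_num
      ring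
    have hzn : ‖z‖ < R / 2 := by simpa using hz
    have hs : 5 / 16 * R ^ 2 ≤ r ^ 2 - ‖z‖ ^ 2 := by
      rw [hr]; nlinarith [norm_nonneg z]
    have hB : ‖deriv f z‖ ^ 2 * (5 / 16 * R ^ 2) ^ 2 ≤ (432 * (1 + ‖f z‖ ^ 2) * r) ^ 2 := by
      calc ‖deriv f z‖ ^ 2 * (5 / 16 * R ^ 2) ^ 2
          ≤ ‖deriv f z‖ ^ 2 * (r ^ 2 - ‖z‖ ^ 2) ^ 2 := by gcongr
        _ = 36 * (g * (a ^ 5 * b ^ 5)) * (r ^ 2 - ‖z‖ ^ 2) ^ 2 := by rw [hfd2]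
        _ ≤ 36 * (g * (16 * (1 + a ^ 6) ^ 2 * ((1 + a) * (1 + b)))) *
            (r ^ 2 - ‖z‖ ^ 2) ^ 2 := by gcongr
        _ = 576 * (1 + a ^ 6) ^ 2 * ((1 + a) * (1 + b) * g * (r ^ 2 - ‖z‖ ^ 2) ^ 2) := by ring
        _ ≤ 576 * (1 + a ^ 6) ^ 2 * (324 * r ^ 2) := by gcongr
        _ = (432 * (1 + ‖f z‖ ^ 2) * r) ^ 2 := by rw [hf2]; ring
    rw [← mul_pow] at hB
    have hB' := le_of_sq_le_sq hB (by positivity)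
    rw [div_lt_div_iff₀ (by positivity) hR]
    have hF : 0 < 1 + ‖f z‖ ^ 2 := by positivity
    have : ‖deriv f z‖ * R * R ≤ 1036.8 * (1 + ‖f z‖ ^ 2) * R := by
      rw [hr] at hB'; linarith
    have := le_of_mul_le_mul_right this hR
    linarith
  exact dist_le_of_eventually_dist_le (γ := fun z => (f z : Sphere)) (convex_ball (0 : ℂ) (R / 2))
    (fun z hz => eventually_chord_le_of_deriv_lt (hfd z (ball_subset_ball (by linarith) hz)) (key z hz)) hz hw

/-- **Montel's theorem**, quantitatively: holomorphic maps from a disc to the sphere omitting three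
given points are uniformly Lipschitz on the half disc for the chordal metric. -/
theorem exists_chord_le_of_omits {p q s : Sphere} (hpq : p ≠ q) (hqs : q ≠ s) (hps : p ≠ s) {R : ℝ}
    (hR : 0 < R) : ∃ C : ℝ, 0 ≤ C ∧ ∀ (A : ℂ → ℂ × ℂ), Differentiable ℂ A →
      (∀ z ∈ ball (0 : ℂ) R, A z ≠ 0 ∧ proj (A z) ≠ p ∧ proj (A z) ≠ q ∧ proj (A z) ≠ s) →
      ∀ z ∈ ball (0 : ℂ) (R / 2), ∀ w ∈ ball (0 : ℂ) (R / 2),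
        chord (proj (A w)) (proj (A z)) ≤ C * ‖w - z‖ := by
  have hne : ∀ x y : Sphere, x ≠ y → wedge (lift x) (lift y) ≠ 0 := fun x y hxy h =>
    hxy (by simpa [proj_lift] using (proj_eq_iff (lift_ne_zero x) (lift_ne_zero y)).2 h)
  have h1 := hne p q hpq
  have h2 := hne q s hqs
  have h3 := hne p s hps
  have hne' : ∀ (u : ℂ × ℂ) (y : Sphere), u ≠ 0 → proj u ≠ y → wedge u (lift y) ≠ 0 :=
    fun u y hu hxy h => hxy (by
      simpa [proj_lift] using (proj_eq_iff hu (lift_ne_zero y)).2 h)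
  generalize hp' : lift p = p' at *
  generalize hq' : lift q = q' at *
  generalize hs' : lift s = s' at *
  -- The linear lift of the Möbius map sending $p,q,s$ to $0,1,\infty$; `D` is its determinant.
  set M : ℂ × ℂ → ℂ × ℂ := fun u => (wedge u p' * wedge q' s', wedge u s' * wedge q' p') with hM
  set D : ℂ := wedge q' s' * wedge q' p' * wedge p' s' with hD
  have h1' : wedge q' p' ≠ 0 := by rw [wedge_swap]; exact neg_ne_zero.2 h1
  have hD0 : D ≠ 0 := mul_ne_zero (mul_ne_zero h2 h1') h3
  have hMw : ∀ u v, wedge (M u) (M v) = D * wedge u v := fun u v => by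
    simp only [hM, hD, wedge]; ring
  set K : ℝ := nrm p' * ‖wedge q' s'‖ + nrm s' * ‖wedge q' p'‖ with hK
  have hK0 : 0 ≤ K := by have := nrm_nonneg p'; have := nrm_nonneg s'; positivity
  have hMn : ∀ u, nrm (M u) ≤ K * nrm u := fun u => by
    have hu := nrm_nonneg u
    have e1 : ‖(M u).1‖ ≤ nrm p' * ‖wedge q' s'‖ * nrm u := by
      simp only [hM, norm_mul]
      nlinarith [mul_le_mul_of_nonneg_right (norm_wedge_le u p') (norm_nonneg (wedge q' s'))]
    have e2 : ‖(M u).2‖ ≤ nrm s' * ‖wedge q' p'‖ * nrm u := by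
      simp only [hM, norm_mul]
      nlinarith [mul_le_mul_of_nonneg_right (norm_wedge_le u s') (norm_nonneg (wedge q' p'))]
    have e3 : nrm (M u) ≤ ‖(M u).1‖ + ‖(M u).2‖ := by
      apply Real.sqrt_le_iff.2 ⟨by positivity, ?_⟩
      nlinarith [norm_nonneg (M u).1, norm_nonneg (M u).2]
    rw [hK]; linarith
  have hM0 : ∀ u, u ≠ 0 → proj u ≠ s → (M u).2 ≠ 0 := fun u hu hus =>
    mul_ne_zero (by rw [← hs']; exact hne' u s hu hus) h1'
  have hMc : ∀ u v, u ≠ 0 → v ≠ 0 → M u ≠ 0 → M v ≠ 0 →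
      chord (proj u) (proj v) ≤ K ^ 2 / ‖D‖ * chord (proj (M u)) (proj (M v)) := by
    intro u v hu hv hMu hMv
    rw [chord_proj hu hv, chord_proj hMu hMv, hMw, norm_mul D]
    have := nrm_pos hu
    have := nrm_pos hv
    have := nrm_pos hMu
    have := nrm_pos hMv
    have := norm_pos_iff.2 hD0
    rw [div_mul_div_comm, div_le_div_iff₀ (by positivity) (by positivity)]
    have hmm : nrm (M u) * nrm (M v) ≤ (K * nrm u) * (K * nrm v) := by
      gcongr
      · exact hMn u
      · exact hMn v
    calc ‖wedge u v‖ * (‖D‖ * (nrm (M u) * nrm (M v)))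
        ≤ ‖wedge u v‖ * (‖D‖ * ((K * nrm u) * (K * nrm v))) := by gcongr
      _ = _ := by ring
  refine ⟨K ^ 2 / ‖D‖ * (2000 / R), by positivity, fun A hA hAo z hz w hw => ?_⟩
  have hsub : ball (0 : ℂ) (R / 2) ⊆ ball 0 R := ball_subset_ball (by linarith)
  have hMA : ∀ z ∈ ball (0 : ℂ) R, (M (A z)).2 ≠ 0 := fun z hz =>
    hM0 _ (hAo z hz).1 (hAo z hz).2.2.2
  have hMA0 : ∀ z ∈ ball (0 : ℂ) R, M (A z) ≠ 0 := fun z hz h => hMA z hz (by rw [h]; rfl)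
  have hprojM : ∀ z ∈ ball (0 : ℂ) R,
      proj (M (A z)) = (((M (A z)).1 / (M (A z)).2 : ℂ) : Sphere) := fun z hz => by
    rw [proj, if_neg (hMA z hz)]
  have hMd : Differentiable ℂ fun z => M (A z) := by
    have hA1 : Differentiable ℂ fun z => (A z).1 := by fun_prop
    have hA2 : Differentiable ℂ fun z => (A z).2 := by fun_prop
    simp only [hM, wedge]
    fun_prop
  have hL := chord_le_of_omits_zero_one (f := fun z => (M (A z)).1 / (M (A z)).2) hR
    (fun z hz => ((hMd.fst z).div (hMd.snd z) (hMA z hz)).differentiableWithinAt)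
    (fun z hz => div_ne_zero (mul_ne_zero (by
      rw [← hp']; exact hne' _ _ (hAo z hz).1 (hAo z hz).2.1) h2) (hMA z hz))
    (fun z hz h => by
      rw [div_eq_one_iff_eq (hMA z hz)] at h
      -- Plücker relation: the two coordinates of $Mu$ differ by $(u\wedge q)(p\wedge s)$.
      have h4 : wedge (A z) q' * wedge p' s' = 0 := by
        have : (M (A z)).1 - (M (A z)).2 = 0 := sub_eq_zero.2 h
        simp only [hM] at this
        rw [← this]
        simp only [wedge]; ring
      refine mul_ne_zero ?_ h3 h4
      rw [← hq']; exact hne' _ _ (hAo z hz).1 (hAo z hz).2.2.1) hz hw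
  rw [← hprojM z (hsub hz), ← hprojM w (hsub hw)] at hL
  calc _ ≤ _ := hMc _ _ (hAo w (hsub hw)).1 (hAo z (hsub hz)).1 (hMA0 w (hsub hw))
        (hMA0 z (hsub hz))
    _ ≤ K ^ 2 / ‖D‖ * (2000 / R * ‖w - z‖) := by gcongr
    _ = _ := by ring

end Metric

/-! ### Rational maps in homogeneous coordinates -/

/-! ### Charts and the open mapping theorem -/

section Metric

attribute [local instance] chordMetric

/-- A parametrised neighbourhood of a point, in homogeneous coordinates. -/
def chart : Sphere → ℂ → ℂ × ℂ
  | ∞ => fun t => (1, t)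
  | (a : ℂ) => fun t => (a + t, 1)

@[simp] theorem chart_infty (t : ℂ) : chart ∞ t = (1, t) := rfl
@[simp] theorem chart_coe (a t : ℂ) : chart (a : Sphere) t = (a + t, 1) := rfl

theorem chart_zero (e : Sphere) : chart e 0 = lift e := by
  cases e using OnePoint.rec <;> simp

theorem chart_ne_zero (e : Sphere) (t : ℂ) : chart e t ≠ 0 := by
  cases e using OnePoint.rec <;> simp [Prod.ext_iff]

theorem differentiable_chart (e : Sphere) : Differentiable ℂ (chart e) := by
  cases e using OnePoint.rec
  · exact (differentiable_const 1).prodMk differentiable_id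
  · exact (differentiable_id.const_add _).prodMk (differentiable_const 1)

theorem isOpenEmbedding_chart (e : Sphere) : IsOpenEmbedding fun t => proj (chart e t) := by
  cases e using OnePoint.rec with
  | infty =>
    have : (fun t => proj (chart ∞ t)) = inversionIsometry ∘ ((↑) : ℂ → Sphere) := by
      ext1 t
      simp [inversionIsometry, inversion]
    rw [this]
    exact inversionIsometry.toHomeomorph.isOpenEmbedding.comp OnePoint.isOpenEmbedding_coe
  | coe a =>
    have : (fun t => proj (chart (a : Sphere) t)) = ((↑) : ℂ → Sphere) ∘ Homeomorph.addLeft a := by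
      ext1 t
      simp [proj]
    rw [this]
    exact OnePoint.isOpenEmbedding_coe.comp (Homeomorph.addLeft a).isOpenEmbedding

theorem map_chart_nhds (e : Sphere) : map (fun t => proj (chart e t)) (𝓝 0) = 𝓝 e := by
  rw [(isOpenEmbedding_chart e).map_nhds_eq, chart_zero, proj_lift]

theorem nhds_le_map_proj_of_snd_ne_zero {A : ℂ → ℂ × ℂ} {t : ℂ} (hA : AnalyticAt ℂ A t)
    (h0 : (A t).2 ≠ 0) (hc : ¬ ∀ᶠ s in 𝓝 t, proj (A s) = proj (A t)) :
    𝓝 (proj (A t)) ≤ map (fun s => proj (A s)) (𝓝 t) := by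
  have h1 : AnalyticAt ℂ (fun s => (A s).1) t := analyticAt_fst.comp hA
  have h2 : AnalyticAt ℂ (fun s => (A s).2) t := analyticAt_snd.comp hA
  have hev : ∀ᶠ s in 𝓝 t, proj (A s) = (((A s).1 / (A s).2 : ℂ) : Sphere) := by
    filter_upwards [h2.continuousAt.eventually_ne h0] with s hs
    rw [proj, if_neg hs]
  rcases (h1.div h2 h0).eventually_constant_or_nhds_le_map_nhds with h | h
  · refine absurd ?_ hc
    filter_upwards [h, hev] with s hs hs'
    rw [hs', hev.self_of_nhds]
    exact congrArg _ hs
  · rw [map_congr hev, hev.self_of_nhds, OnePoint.nhds_coe_eq]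
    exact map_mono h

theorem nhds_le_map_proj {A : ℂ → ℂ × ℂ} {t : ℂ} (hA : AnalyticAt ℂ A t)
    (h0 : A t ≠ 0) (hc : ¬ ∀ᶠ s in 𝓝 t, proj (A s) = proj (A t)) :
    𝓝 (proj (A t)) ≤ map (fun s => proj (A s)) (𝓝 t) := by
  by_cases h2 : (A t).2 = 0
  · have h1 : (A t).1 ≠ 0 := fun h1 => h0 (Prod.ext h1 h2)
    have hne : ∀ᶠ s in 𝓝 t, A s ≠ 0 := hA.continuousAt.eventually_ne h0
    have hsw : AnalyticAt ℂ (fun s => (A s).swap) t :=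
      (analyticAt_snd.comp hA).prod (analyticAt_fst.comp hA)
    have hinv : ∀ᶠ s in 𝓝 t, proj (A s) = inversion (proj (A s).swap) := by
      filter_upwards [hne] with s hs
      rw [← inversion_proj hs, inversion_inversion]
    have h := nhds_le_map_proj_of_snd_ne_zero hsw h1 (fun hcon => hc (by
      filter_upwards [hcon, hinv] with s hs hs'
      rw [hs', hs, ← hinv.self_of_nhds]))
    rw [map_congr hinv, hinv.self_of_nhds]
    have e := inversionIsometry.toHomeomorph.map_nhds_eq (proj (A t).swap)
    change map inversion _ = 𝓝 (inversion _) at e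
    rw [← e]
    exact (map_mono h).trans_eq map_map
  · exact nhds_le_map_proj_of_snd_ne_zero hA h2 hc

end Metric

/-- The homogenisation of degree `d` of a polynomial of degree at most `d`. -/
def homEval (d : ℕ) (p : Polynomial ℂ) (u : ℂ × ℂ) : ℂ :=
  ∑ i ∈ Finset.range (d + 1), p.coeff i * u.1 ^ i * u.2 ^ (d - i)

theorem homEval_eq_eval {d : ℕ} {p : Polynomial ℂ} (hp : p.natDegree ≤ d) (z : ℂ) :
    homEval d p (z, 1) = p.eval z := by
  rw [Polynomial.eval_eq_sum_range' (Nat.lt_succ_of_le hp)]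
  simp [homEval]

theorem homEval_smul (d : ℕ) (p : Polynomial ℂ) (c : ℂ) (u : ℂ × ℂ) :
    homEval d p (c • u) = c ^ d * homEval d p u := by
  rw [homEval, homEval, Finset.mul_sum]
  refine Finset.sum_congr rfl fun i hi => ?_
  have : c ^ d = c ^ i * c ^ (d - i) := by
    rw [← pow_add, Nat.add_sub_cancel' (Nat.lt_succ_iff.1 (Finset.mem_range.1 hi))]
  rw [this]
  simp only [Prod.smul_fst, Prod.smul_snd, smul_eq_mul, mul_pow]
  ring

theorem homEval_one_zero (d : ℕ) (p : Polynomial ℂ) : homEval d p (1, 0) = p.coeff d := by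
  rw [homEval, Finset.sum_range_succ]
  rw [Finset.sum_eq_zero fun i hi => ?_]
  · simp
  · rw [zero_pow (Nat.sub_ne_zero_of_lt (Finset.mem_range.1 hi)), mul_zero]

theorem homEval_C {d : ℕ} (c : ℂ) (u : ℂ × ℂ) :
    homEval d (Polynomial.C c) u = c * u.2 ^ d := by
  rw [homEval, Finset.sum_range_succ', Finset.sum_eq_zero fun i _ => ?_]
  · simp
  · simp

theorem differentiable_homEval (d : ℕ) (p : Polynomial ℂ) : Differentiable ℂ (homEval d p) := by
  unfold homEval
  fun_prop

/-- A rational map in homogeneous coordinates. -/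
def homMap (f : RatFunc ℂ) (u : ℂ × ℂ) : ℂ × ℂ :=
  (homEval (ratDegree f) f.num u, homEval (ratDegree f) f.denom u)

theorem differentiable_homMap (f : RatFunc ℂ) : Differentiable ℂ (homMap f) :=
  (differentiable_homEval _ _).prodMk (differentiable_homEval _ _)

theorem homMap_smul (f : RatFunc ℂ) (c : ℂ) (u : ℂ × ℂ) :
    homMap f (c • u) = c ^ ratDegree f • homMap f u :=
  Prod.ext (homEval_smul _ _ _ _) (homEval_smul _ _ _ _)

theorem homMap_coe (f : RatFunc ℂ) (z : ℂ) : homMap f (z, 1) = (f.num.eval z, f.denom.eval z) :=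
  Prod.ext (homEval_eq_eval (le_max_left _ _) z) (homEval_eq_eval (le_max_right _ _) z)

theorem homMap_infty (f : RatFunc ℂ) :
    homMap f (1, 0) = (f.num.coeff (ratDegree f), f.denom.coeff (ratDegree f)) :=
  Prod.ext (homEval_one_zero _ _) (homEval_one_zero _ _)

/-- No indeterminacy: numerator and denominator are coprime at finite points, and at $\infty$ one of
them has a nonzero coefficient in the top degree. -/
theorem homMap_lift_ne_zero {f : RatFunc ℂ} (hf : 2 ≤ ratDegree f) (p : Sphere) :
    homMap f (lift p) ≠ 0 := by
  cases p using OnePoint.rec with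
  | infty =>
    rw [lift_infty, homMap_infty]
    intro h
    simp only [Prod.mk_eq_zero] at h
    rcases max_choice f.num.natDegree f.denom.natDegree with hd | hd
    · rw [ratDegree, hd] at h hf
      rw [Polynomial.coeff_natDegree, Polynomial.leadingCoeff_eq_zero] at h
      rw [h.1] at hf
      simp at hf
    · rw [ratDegree, hd] at h
      rw [Polynomial.coeff_natDegree, Polynomial.leadingCoeff_eq_zero] at h
      exact f.denom_ne_zero h.2
  | coe z =>
    rw [lift_coe, homMap_coe]
    intro h
    simp only [Prod.mk_eq_zero] at h
    obtain ⟨a, b, hab⟩ := f.isCoprime_num_denom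
    have := congrArg (Polynomial.eval z) hab
    simp [h.1, h.2] at this

theorem proj_homMap_lift {f : RatFunc ℂ} (p : Sphere) :
    proj (homMap f (lift p)) = ratMap f p := by
  cases p using OnePoint.rec with
  | infty =>
    rw [lift_infty, homMap_infty, ratMap_infty, proj]
    by_cases h : f.denom.natDegree < f.num.natDegree
    · have hd : ratDegree f = f.num.natDegree := max_eq_left h.le
      rw [if_pos h, if_pos]
      rw [hd]; exact Polynomial.coeff_eq_zero_of_natDegree_lt h
    · have hd : ratDegree f = f.denom.natDegree := max_eq_right (not_lt.1 h)
      rw [if_neg h, hd, if_neg, Polynomial.coeff_natDegree]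
      simpa using f.denom_ne_zero
  | coe z => rw [lift_coe, homMap_coe, ratMap_coe, proj]

theorem homMap_ne_zero {f : RatFunc ℂ} (hf : 2 ≤ ratDegree f) {u : ℂ × ℂ} (hu : u ≠ 0) :
    homMap f u ≠ 0 := by
  obtain ⟨c, hc, h⟩ := exists_lift_proj hu
  have := homMap_lift_ne_zero hf (proj u)
  rw [h, homMap_smul] at this
  exact fun h0 => this (by rw [h0, smul_zero])

theorem proj_homMap (f : RatFunc ℂ) {u : ℂ × ℂ} (hu : u ≠ 0) :
    proj (homMap f u) = ratMap f (proj u) := by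
  obtain ⟨c, hc, h⟩ := exists_lift_proj hu
  rw [← proj_homMap_lift, h, homMap_smul, proj_smul (pow_ne_zero _ hc)]

theorem iterate_homMap {f : RatFunc ℂ} (hf : 2 ≤ ratDegree f) (n : ℕ) {u : ℂ × ℂ} (hu : u ≠ 0) :
    (homMap f)^[n] u ≠ 0 ∧ proj ((homMap f)^[n] u) = (ratMap f)^[n] (proj u) := by
  induction n with
  | zero => exact ⟨hu, rfl⟩
  | succ n ih =>
    rw [Function.iterate_succ_apply', Function.iterate_succ_apply']
    exact ⟨homMap_ne_zero hf ih.1, by rw [proj_homMap f ih.1, ih.2]⟩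

/-- The polynomial whose zeros are the finite preimages of a point. -/
def fiberPoly (f : RatFunc ℂ) (v : ℂ × ℂ) : Polynomial ℂ :=
  Polynomial.C v.2 * f.num - Polynomial.C v.1 * f.denom

/-- A fibre is the zero set of a binary form of degree $d$; it contains $\infty$ exactly when
`fiberPoly` has degree below $d$. -/
theorem wedge_homMap (f : RatFunc ℂ) (u v : ℂ × ℂ) :
    wedge (homMap f u) v = homEval (ratDegree f) (fiberPoly f v) u := by
  simp only [wedge, homMap, homEval, fiberPoly, Polynomial.coeff_sub, Polynomial.coeff_C_mul]
  rw [Finset.sum_mul, Finset.sum_mul, ← Finset.sum_sub_distrib]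
  exact Finset.sum_congr rfl fun i _ => by ring

theorem natDegree_fiberPoly_le (f : RatFunc ℂ) (v : ℂ × ℂ) :
    (fiberPoly f v).natDegree ≤ ratDegree f := by
  refine (Polynomial.natDegree_sub_le _ _).trans (max_le_max ?_ ?_) <;>
    exact Polynomial.natDegree_C_mul_le _ _

theorem fiberPoly_ne_zero {f : RatFunc ℂ} (hf : 2 ≤ ratDegree f) {v : ℂ × ℂ} (hv : v ≠ 0) :
    fiberPoly f v ≠ 0 := by
  intro h
  rw [fiberPoly, sub_eq_zero] at h
  have hco := f.isCoprime_num_denom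
  have unit_of : ∀ p q : Polynomial ℂ, ∀ a b : ℂ, IsCoprime p q → a ≠ 0 →
      Polynomial.C a * p = Polynomial.C b * q → q.natDegree = 0 ∧ p.natDegree = 0 := by
    intro p q a b hpq ha h
    have hp : p = q * Polynomial.C (a⁻¹ * b) := by
      have := congrArg (Polynomial.C a⁻¹ * ·) h
      simp only [← mul_assoc, ← Polynomial.C_mul, inv_mul_cancel₀ ha, Polynomial.C_1,
        one_mul] at this
      rw [this, mul_comm]
    have hq : IsUnit q := hpq.symm.isUnit_of_dvd' dvd_rfl ⟨_, hp⟩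
    have hq0 := Polynomial.natDegree_eq_zero_of_isUnit hq
    refine ⟨hq0, ?_⟩
    rw [hp]
    have := Polynomial.natDegree_mul_C_le q (a⁻¹ * b)
    omega
  by_cases h2 : v.2 = 0
  · have h1 : v.1 ≠ 0 := fun h1 => hv (Prod.ext h1 h2)
    have := unit_of _ _ _ _ hco.symm h1 h.symm
    simp [ratDegree, this.1, this.2] at hf
  · have := unit_of _ _ _ _ hco h2 h
    simp [ratDegree, this.1, this.2] at hf

theorem ratMap_eq_iff {f : RatFunc ℂ} (hf : 2 ≤ ratDegree f) (p q : Sphere) :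
    ratMap f p = q ↔ homEval (ratDegree f) (fiberPoly f (lift q)) (lift p) = 0 := by
  rw [← wedge_homMap, ← proj_eq_iff (homMap_lift_ne_zero hf p) (lift_ne_zero q),
    proj_homMap_lift, proj_lift]

theorem ratMap_coe_eq_iff {f : RatFunc ℂ} (hf : 2 ≤ ratDegree f) (z : ℂ) (q : Sphere) :
    ratMap f z = q ↔ (fiberPoly f (lift q)).eval z = 0 := by
  rw [ratMap_eq_iff hf, lift_coe, homEval_eq_eval (natDegree_fiberPoly_le _ _)]

theorem ratMap_infty_eq_iff {f : RatFunc ℂ} (hf : 2 ≤ ratDegree f) (q : Sphere) :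
    ratMap f ∞ = q ↔ (fiberPoly f (lift q)).coeff (ratDegree f) = 0 := by
  rw [ratMap_eq_iff hf, lift_infty, homEval_one_zero]

theorem surjective_ratMap {f : RatFunc ℂ} (hf : 2 ≤ ratDegree f) :
    Function.Surjective (ratMap f) := by
  intro q
  by_cases hd : (fiberPoly f (lift q)).natDegree = 0
  · refine ⟨∞, (ratMap_infty_eq_iff hf q).2 ?_⟩
    exact Polynomial.coeff_eq_zero_of_natDegree_lt (by omega)
  · obtain ⟨z, hz⟩ := IsAlgClosed.exists_root (fiberPoly f (lift q))
      (fun h => hd (Polynomial.natDegree_eq_zero_iff_degree_le_zero.2 h.le))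
    exact ⟨z, (ratMap_coe_eq_iff hf z q).2 hz⟩

theorem finite_fiber_ratMap {f : RatFunc ℂ} (hf : 2 ≤ ratDegree f) (q : Sphere) :
    (ratMap f ⁻¹' {q}).Finite := by
  have hne := fiberPoly_ne_zero hf (lift_ne_zero q)
  refine ((Polynomial.finite_setOfPred_isRoot hne).image ((↑) : ℂ → Sphere)).insert ∞ |>.subset ?_
  intro p hp
  cases p using OnePoint.rec with
  | infty => exact mem_insert _ _
  | coe z => exact mem_insert_of_mem _ ⟨z, (ratMap_coe_eq_iff hf z q).1 hp, rfl⟩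

/-! ### Points alone in their fibre -/

theorem eq_C_mul_pow_of_forall_root {p : Polynomial ℂ} {a : ℂ} (h : ∀ z, p.eval z = 0 → z = a) :
    p = Polynomial.C p.leadingCoeff * (Polynomial.X - Polynomial.C a) ^ p.natDegree := by
  have hs := IsAlgClosed.splits p
  have hr : p.roots = Multiset.replicate p.natDegree a := by
    rw [Multiset.eq_replicate]
    exact ⟨hs.natDegree_eq_card_roots.symm, fun z hz => h z (Polynomial.isRoot_of_mem_roots hz)⟩
  conv_lhs => rw [hs.eq_prod_roots, hr]
  simp

/-- A binary form with a single zero is a multiple of the $d$-th power of the linear form vanishing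
there. -/
theorem wedge_homMap_chart {f : RatFunc ℂ} (hf : 2 ≤ ratDegree f) {e : Sphere}
    (he : ∀ p, ratMap f p = ratMap f e → p = e) :
    ∃ κ : ℂ, ∀ t, wedge (homMap f (chart e t)) (lift (ratMap f e)) =
      κ * wedge (chart e t) (lift e) ^ ratDegree f := by
  simp only [wedge_homMap]
  set R := fiberPoly f (lift (ratMap f e)) with hR
  cases e using OnePoint.rec with
  | infty =>
    have hd : R.natDegree = 0 := by
      by_contra hd
      obtain ⟨z, hz⟩ := IsAlgClosed.exists_root R
        (fun h => hd (Polynomial.natDegree_eq_zero_iff_degree_le_zero.2 h.le))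
      exact OnePoint.coe_ne_infty z (he z ((ratMap_coe_eq_iff hf z _).2 hz))
    refine ⟨R.coeff 0 * (-1) ^ ratDegree f, fun t => ?_⟩
    rw [Polynomial.eq_C_of_natDegree_eq_zero hd, homEval_C]
    simp [wedge, mul_assoc, ← mul_pow]
  | coe a =>
    have hroot : ∀ z, R.eval z = 0 → z = a := fun z hz =>
      OnePoint.coe_injective (he z ((ratMap_coe_eq_iff hf z _).2 hz))
    have hdeg : R.natDegree = ratDegree f := by
      refine le_antisymm (natDegree_fiberPoly_le _ _) ?_
      by_contra! hlt
      exact OnePoint.infty_ne_coe a (he ∞ ((ratMap_infty_eq_iff hf _).2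
        (Polynomial.coeff_eq_zero_of_natDegree_lt hlt)))
    refine ⟨R.leadingCoeff, fun t => ?_⟩
    rw [chart_coe, homEval_eq_eval hdeg.le, eq_C_mul_pow_of_forall_root hroot, hdeg]
    simp [wedge]

/-- Near a point that is alone in its fibre, a rational map of degree at least two is quadratically
contracting. -/
theorem eventually_chord_ratMap_le {f : RatFunc ℂ} (hf : 2 ≤ ratDegree f) {e : Sphere}
    (he : ∀ p, ratMap f p = ratMap f e → p = e) :
    ∃ C : ℝ, 0 < C ∧ ∀ᶠ p in 𝓝 e, chord (ratMap f p) (ratMap f e) ≤ C * chord p e ^ 2 := by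
  obtain ⟨κ, hκ⟩ := wedge_homMap_chart hf he
  set d := ratDegree f with hd
  set v := lift (ratMap f e) with hv
  set φ : ℂ → ℝ := fun t => ‖κ‖ * (nrm (chart e t) * nrm (lift e)) ^ d /
    (nrm (homMap f (chart e t)) * nrm v) with hφ
  have hn : Continuous nrm := by unfold nrm; fun_prop
  have hch := (differentiable_chart e).continuous
  have hF := (differentiable_homMap f).continuous
  have hF0 : ∀ t, homMap f (chart e t) ≠ 0 := fun t => homMap_ne_zero hf (chart_ne_zero e t)
  have hφc : Continuous φ := by
    refine Continuous.div (by fun_prop) (by fun_prop) fun t => ?_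
    exact (mul_pos (nrm_pos (hF0 t)) (nrm_pos (lift_ne_zero _))).ne'
  have hφ0 : 0 ≤ φ 0 := by
    have := nrm_nonneg (chart e 0)
    have := nrm_nonneg (lift e)
    have := nrm_nonneg (homMap f (chart e 0))
    have := nrm_nonneg v
    simp only [hφ]; positivity
  refine ⟨φ 0 + 1, by linarith, ?_⟩
  rw [← map_chart_nhds, eventually_map]
  filter_upwards [(hφc.tendsto 0).eventually_lt_const (lt_add_one (φ 0))] with t ht
  have h1 := nrm_pos (chart_ne_zero e t)
  have h2 := nrm_pos (lift_ne_zero e)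
  have h3 := nrm_pos (hF0 t)
  have h4 := nrm_pos (lift_ne_zero (ratMap f e))
  have hc : chord (proj (chart e t)) e =
      ‖wedge (chart e t) (lift e)‖ / (nrm (chart e t) * nrm (lift e)) := by
    rw [chord_comm, chord_proj_right e (chart_ne_zero e t), wedge_swap, norm_neg, mul_comm]
  have hfc : chord (ratMap f (proj (chart e t))) (ratMap f e) =
      φ t * chord (proj (chart e t)) e ^ d := by
    rw [← proj_homMap f (chart_ne_zero e t), chord_comm, chord_proj_right _ (hF0 t), wedge_swap,
      norm_neg, hκ, norm_mul, norm_pow, hc, div_pow]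
    simp only [hφ, hv]
    field_simp
  rw [hfc]
  have hcd : chord (proj (chart e t)) e ^ d ≤ chord (proj (chart e t)) e ^ 2 :=
    pow_le_pow_of_le_one (chord_nonneg _ _) (chord_le_one _ _) hf
  have h0 := chord_nonneg (proj (chart e t)) e
  gcongr

section Metric

attribute [local instance] chordMetric

theorem isOpenMap_ratMap {f : RatFunc ℂ} (hf : 2 ≤ ratDegree f) : IsOpenMap (ratMap f) := by
  rw [isOpenMap_iff_nhds_le]
  intro e
  have hA : Differentiable ℂ fun t => homMap f (chart e t) :=
    (differentiable_homMap f).comp (differentiable_chart e)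
  have e1 : ∀ t, proj (homMap f (chart e t)) = ratMap f (proj (chart e t)) :=
    fun t => proj_homMap f (chart_ne_zero e t)
  have h := nhds_le_map_proj (hA.analyticAt 0) (homMap_ne_zero hf (chart_ne_zero e 0)) ?_
  · simp only [e1, chart_zero] at h
    rw [proj_homMap_lift] at h
    rw [← map_chart_nhds e, map_map]
    exact h
  · simp only [e1]
    intro hcon
    have hfin := (finite_fiber_ratMap hf (ratMap f (proj (chart e 0)))).preimage
      (isOpenEmbedding_chart e).injective.injOn
    exact (infinite_of_mem_nhds (0 : ℂ) hcon) hfin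

/-- Under injectivity every point is alone in its fibre, so quadratic contraction holds everywhere.
The map is then $\varepsilon$-Lipschitz on the plane for every $\varepsilon>0$. -/
theorem not_injective_ratMap {f : RatFunc ℂ} (hf : 2 ≤ ratDegree f) :
    ¬ Function.Injective (ratMap f) := by
  intro hinj
  have hlip : ∀ ε > 0, ∀ z w : ℂ, chord (ratMap f w) (ratMap f z) ≤ ε * ‖w - z‖ := by
    intro ε hε z w
    refine dist_le_of_eventually_dist_le (γ := fun z : ℂ => ratMap f z) convex_univ
      (fun z _ => ?_) (mem_univ z) (mem_univ w)
    obtain ⟨C, hC, h⟩ := eventually_chord_ratMap_le hf (e := z) fun p hp => hinj hp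
    rw [OnePoint.nhds_coe_eq, eventually_map] at h
    filter_upwards [h, ball_mem_nhds z (div_pos hε hC)] with w hw hwz
    have hwz : ‖w - z‖ < ε / C := by simpa [dist_eq_norm] using hwz
    rw [lt_div_iff₀ hC] at hwz
    refine hw.trans ?_
    have hc := chord_coe_coe_le w z
    have hc0 := chord_nonneg w z
    calc C * chord w z ^ 2 ≤ C * ‖w - z‖ ^ 2 := by gcongr
      _ = ‖w - z‖ * C * ‖w - z‖ := by ring
      _ ≤ ε * ‖w - z‖ := by gcongr
  have h0 : chord (ratMap f (1 : ℂ)) (ratMap f (0 : ℂ)) ≤ 0 :=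
    le_of_forall_gt_imp_ge_of_dense fun ε hε => by simpa using hlip ε hε 0 1
  have := hinj (eq_of_chord_eq_zero (h0.antisymm (chord_nonneg _ _)))
  exact one_ne_zero (OnePoint.coe_injective this)

end Metric

/-! ### Fatou and Julia sets -/

section Metric

attribute [local instance] chordMetric

/-- Every sequence of iterates has a subsequence converging uniformly on `N`. -/
def IsUniformlyNormalOn (f : Sphere → Sphere) (N : Set Sphere) : Prop :=
  ∀ a : ℕ → ℕ, ∃ φ : ℕ → ℕ, StrictMono φ ∧ ∃ g : Sphere → Sphere,
    ∀ ε > 0, ∃ n₀, ∀ n ≥ n₀, ∀ z ∈ N, chord (f^[a (φ n)] z) (g z) < ε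

theorem mem_fatouSet_iff {f : Sphere → Sphere} {p : Sphere} :
    p ∈ fatouSet f ↔ ∃ N ∈ 𝓝 p, IsUniformlyNormalOn f N := by
  constructor
  · rintro ⟨U, ⟨hU, hn⟩, hp⟩
    obtain ⟨K, hK, hpK, hKU⟩ := exists_compact_subset hU hp
    refine ⟨K, mem_interior_iff_mem_nhds.1 hpK, fun a => ?_⟩
    obtain ⟨φ, hφ, g, hg⟩ := hn a
    refine ⟨φ, hφ, g, fun ε hε => ?_⟩
    obtain ⟨n₀, h⟩ := hg K hKU hK ε hε
    exact ⟨n₀, fun n hn z hz => (chord_le_sphericalDist _ _).trans_lt (h n hn z hz)⟩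
  · rintro ⟨N, hN, hn⟩
    refine ⟨interior N, ⟨isOpen_interior, fun a => ?_⟩, mem_interior_iff_mem_nhds.2 hN⟩
    obtain ⟨φ, hφ, g, hg⟩ := hn a
    refine ⟨φ, hφ, g, fun K hK _ ε hε => ?_⟩
    obtain ⟨n₀, h⟩ := hg (ε / Real.pi) (div_pos hε Real.pi_pos)
    refine ⟨n₀, fun n hn z hz => (sphericalDist_le _ _).trans_lt ?_⟩
    have := h n hn z (interior_subset (hK hz))
    rwa [lt_div_iff₀' Real.pi_pos] at this

theorem isClosed_juliaSet (f : Sphere → Sphere) : IsClosed (juliaSet f) :=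
  (isOpen_sUnion fun _ hU => hU.1).isClosed_compl

/-- A set-theoretic section `s` of `f` over `f '' N` transports limits. It need not be continuous,
since uniform convergence alone is required. -/
theorem map_mem_fatouSet {f : Sphere → Sphere} (hopen : IsOpenMap f) {p : Sphere}
    (hp : p ∈ fatouSet f) : f p ∈ fatouSet f := by
  rw [mem_fatouSet_iff] at hp ⊢
  obtain ⟨N, hN, hn⟩ := hp
  refine ⟨f '' N, hopen.image_mem_nhds hN, fun a => ?_⟩
  obtain ⟨φ, hφ, g, hg⟩ := hn fun n => a n + 1
  have hs : ∀ y, ∃ x, y ∈ f '' N → x ∈ N ∧ f x = y := fun y => by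
    by_cases hy : y ∈ f '' N
    · obtain ⟨x, hx⟩ := hy
      exact ⟨x, fun _ => hx⟩
    · exact ⟨∞, fun h => absurd h hy⟩
  choose s hs using hs
  refine ⟨φ, hφ, fun y => g (s y), fun ε hε => ?_⟩
  obtain ⟨n₀, h⟩ := hg ε hε
  refine ⟨n₀, fun n hn y hy => ?_⟩
  have := h n hn (s y) (hs y hy).1
  rwa [Function.iterate_succ_apply, (hs y hy).2] at this

theorem preimage_juliaSet_subset {f : Sphere → Sphere} (hopen : IsOpenMap f) :
    f ⁻¹' juliaSet f ⊆ juliaSet f := fun _ hp hF => hp (map_mem_fatouSet hopen hF)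

/-- By surjectivity $f^{-1}(S)$ has at least as many points as $S$. -/
theorem completelyInvariant_of_preimage_subset {f : Sphere → Sphere} (hf : Function.Surjective f)
    {S : Set Sphere} (hS : S.Finite) (h : f ⁻¹' S ⊆ S) : CompletelyInvariant f S := by
  have e : f '' (f ⁻¹' S) = S := image_preimage_eq S hf
  have h1 : f ⁻¹' S = S := by
    refine eq_of_subset_of_ncard_le h ?_ hS
    conv_lhs => rw [← e]
    exact ncard_image_le (hS.subset h)
  exact ⟨by rwa [h1] at e, h1⟩

/-- A surjective self-map of a finite set is injective, and the fibre stays inside $E$. -/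
theorem CompletelyInvariant.eq_of_apply_eq {f : Sphere → Sphere} {E : Set Sphere} (hE : E.Finite)
    (h : CompletelyInvariant f E) {e p : Sphere} (he : e ∈ E) (hp : f p = f e) : p = e := by
  have hinj : InjOn f E := injOn_of_ncard_image_eq (by rw [h.1]) hE
  have hfe : f e ∈ E := h.1 ▸ mem_image_of_mem f he
  have hpE : p ∈ E := by
    rw [← h.2, mem_preimage, hp]; exact hfe
  exact hinj hpE he hp

/-- A finite completely invariant set of superattracting points lies in the Fatou set. -/
theorem exceptionalSet_subset_fatouSet {f : RatFunc ℂ} (hf : 2 ≤ ratDegree f) :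
    exceptionalSet (ratMap f) ⊆ fatouSet (ratMap f) := by
  rintro e ⟨E, ⟨hEfin, hE⟩, he⟩
  have hδ : ∀ e ∈ E, ∀ᶠ δ in 𝓝[>] (0 : ℝ), ∀ p, chord p e < δ →
      chord (ratMap f p) (ratMap f e) ≤ 1 / 2 * chord p e := by
    intro e he
    obtain ⟨C, hC, h⟩ := eventually_chord_ratMap_le hf fun p => hE.eq_of_apply_eq hEfin he
    obtain ⟨δ₁, hδ₁, h⟩ := Metric.eventually_nhds_iff.1 h
    filter_upwards [Ioo_mem_nhdsGT (show 0 < min δ₁ (1 / (2 * C)) by positivity)] with δ hδ p hp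
    have h1 := h ((hp.trans hδ.2).trans_le (min_le_left _ _))
    have h2 : chord p e < 1 / (2 * C) := (hp.trans hδ.2).trans_le (min_le_right _ _)
    rw [lt_div_iff₀ (by positivity)] at h2
    have h0 := chord_nonneg p e
    nlinarith
  obtain ⟨δ, hδ0, hδ⟩ :=
    ((eventually_mem_nhdsWithin (a := (0 : ℝ)) (s := Ioi 0)).and ((eventually_all_finite hEfin).2 hδ)).exists
  have hδ0 : 0 < δ := hδ0
  have hmaps : ∀ n, (ratMap f)^[n] e ∈ E := fun n => by
    induction n with
    | zero => exact he
    | succ n ih =>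
      rw [Function.iterate_succ_apply', ← hE.1]
      exact mem_image_of_mem _ ih
  have hcontr : ∀ p, chord p e < δ → ∀ n,
      chord ((ratMap f)^[n] p) ((ratMap f)^[n] e) ≤ (1 / 2) ^ n * chord p e := by
    intro p hp n
    induction n with
    | zero => simp
    | succ n ih =>
      rw [Function.iterate_succ_apply', Function.iterate_succ_apply']
      have h0 := chord_nonneg p e
      have h1 : (1 / 2 : ℝ) ^ n * chord p e ≤ chord p e :=
        mul_le_of_le_one_left h0 (pow_le_one₀ (by norm_num) (by norm_num))
      refine (hδ _ (hmaps n) _ ((ih.trans h1).trans_lt hp)).trans ?_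
      rw [pow_succ]; linarith
  rw [mem_fatouSet_iff]
  refine ⟨ball e δ, ball_mem_nhds e hδ0, fun a => ?_⟩
  -- Either some exponent recurs and a constant subsequence works, or the exponents tend to infinity
  -- and every orbit from the ball shadows that of $e$, which converges along a subsequence.
  by_cases hfreq : ∃ m, ∃ᶠ n in atTop, a n = m
  · obtain ⟨m, hm⟩ := hfreq
    obtain ⟨φ, hφ, h⟩ := extraction_of_frequently_atTop hm
    exact ⟨φ, hφ, (ratMap f)^[m], fun ε hε => ⟨0, fun n _ z _ => by rwa [h, chord_self]⟩⟩
  · simp only [not_exists, not_frequently] at hfreq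
    have ha : Tendsto a atTop atTop := by
      refine tendsto_atTop.2 fun m => ?_
      filter_upwards [(eventually_all_finite (finite_Iio m)).2 fun i _ => hfreq i] with n hn
      exact not_lt.1 fun hlt => hn _ hlt rfl
    obtain ⟨q, -, φ, hφ, hq⟩ := isCompact_univ.tendsto_subseq
      (x := fun n => (ratMap f)^[a n] e) (fun _ => mem_univ _)
    refine ⟨φ, hφ, fun _ => q, fun ε hε => ?_⟩
    have h1 : Tendsto (fun n => (1 / 2 : ℝ) ^ a (φ n) +
        chord ((ratMap f)^[a (φ n)] e) q) atTop (𝓝 (0 + 0)) :=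
      ((tendsto_pow_atTop_nhds_zero_of_lt_one (by norm_num) (by norm_num)).comp
        (ha.comp hφ.tendsto_atTop)).add (tendsto_iff_dist_tendsto_zero.1 hq)
    rw [add_zero] at h1
    obtain ⟨n₀, hn₀⟩ := eventually_atTop.1 (h1.eventually_lt_const hε)
    refine ⟨n₀, fun n hn z hz => ?_⟩
    refine lt_of_le_of_lt ?_ (hn₀ n hn)
    refine (chord_triangle _ ((ratMap f)^[a (φ n)] e) _).trans ?_
    gcongr
    refine (hcontr z hz _).trans ?_
    exact mul_le_of_le_one_right (by positivity) (chord_le_one _ _)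

/-! ### Normality from omitted values, and density of backward orbits -/

theorem exists_subseq_tendsto_uniformly {α X : Type*} [PseudoMetricSpace α] [CompactSpace α]
    [MetricSpace X] [CompactSpace X] {F : ℕ → α → X} {K : NNReal}
    (hF : ∀ n, LipschitzWith K (F n)) (a : ℕ → ℕ) :
    ∃ φ : ℕ → ℕ, StrictMono φ ∧ ∃ G : α → X,
      ∀ ε > 0, ∃ n₀, ∀ n ≥ n₀, ∀ t, dist (F (a (φ n)) t) (G t) < ε := by
  set B : ℕ → BoundedContinuousFunction α X := fun n =>
    BoundedContinuousFunction.mkOfCompact ⟨_, (hF n).continuous⟩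
  have hcpt : IsCompact (closure (range B)) := by
    refine BoundedContinuousFunction.arzela_ascoli univ isCompact_univ _ (fun _ _ _ => mem_univ _) ?_
    refine (LipschitzWith.uniformEquicontinuous _ K ?_).equicontinuous
    rintro ⟨_, n, rfl⟩
    exact hF n
  obtain ⟨G, -, φ, hφ, hG⟩ := hcpt.tendsto_subseq (x := fun n => B (a n))
    (fun n => subset_closure (mem_range_self _))
  refine ⟨φ, hφ, G, fun ε hε => ?_⟩
  obtain ⟨n₀, hn₀⟩ := Metric.tendsto_atTop.1 hG ε hε
  exact ⟨n₀, fun n hn t => (BoundedContinuousFunction.dist_coe_le_dist t).trans_lt (hn₀ n hn)⟩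

theorem mem_fatouSet_of_omits {f : RatFunc ℂ} (hf : 2 ≤ ratDegree f) {p q₁ q₂ q₃ : Sphere}
    (h₁₂ : q₁ ≠ q₂) (h₂₃ : q₂ ≠ q₃) (h₁₃ : q₁ ≠ q₃) {U : Set Sphere} (hU : U ∈ 𝓝 p)
    (hom : ∀ n, ∀ z ∈ U, (ratMap f)^[n] z ≠ q₁ ∧ (ratMap f)^[n] z ≠ q₂ ∧ (ratMap f)^[n] z ≠ q₃) :
    p ∈ fatouSet (ratMap f) := by
  rw [← map_chart_nhds, mem_map] at hU
  obtain ⟨R, hR, hRU⟩ := Metric.mem_nhds_iff.1 hU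
  obtain ⟨C, hC, hLip⟩ := exists_chord_le_of_omits h₁₂ h₂₃ h₁₃ hR
  have hit := fun n t => iterate_homMap hf n (chart_ne_zero p t)
  have hdiff : ∀ n, Differentiable ℂ fun t => (homMap f)^[n] (chart p t) := fun n =>
    ((differentiable_homMap f).iterate n).comp (differentiable_chart p)
  have hlip : ∀ n, ∀ z ∈ ball (0 : ℂ) (R / 2), ∀ w ∈ ball (0 : ℂ) (R / 2),
      chord ((ratMap f)^[n] (proj (chart p w))) ((ratMap f)^[n] (proj (chart p z))) ≤
        C * ‖w - z‖ := by
    intro n z hz w hw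
    have := hLip _ (hdiff n) (fun z hz => ⟨(hit n z).1, by
      rw [(hit n z).2]; exact hom n _ (hRU hz)⟩) z hz w hw
    rwa [(hit n z).2, (hit n w).2] at this
  have hsub : closedBall (0 : ℂ) (R / 4) ⊆ ball 0 (R / 2) := closedBall_subset_ball (by linarith)
  have hcomp : CompactSpace (closedBall (0 : ℂ) (R / 4)) :=
    isCompact_iff_compactSpace.1 (isCompact_closedBall _ _)
  have hlw : ∀ n, LipschitzWith ⟨C, hC⟩ fun t : closedBall (0 : ℂ) (R / 4) =>
      (ratMap f)^[n] (proj (chart p t)) := fun n =>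
    LipschitzWith.of_dist_le_mul fun t s => by
      have := hlip n s (hsub s.2) t (hsub t.2)
      rwa [← dist_eq_norm] at this
  rw [mem_fatouSet_iff]
  refine ⟨(fun t => proj (chart p t)) '' closedBall 0 (R / 4), ?_, fun a => ?_⟩
  · rw [← map_chart_nhds p]
    exact image_mem_map (closedBall_mem_nhds _ (by linarith))
  obtain ⟨φ, hφ, G, hG⟩ := exists_subseq_tendsto_uniformly hlw a
  have hinj : Function.Injective fun t : closedBall (0 : ℂ) (R / 4) => proj (chart p t) :=
    (isOpenEmbedding_chart p).injective.comp Subtype.val_injective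
  -- The limit is moved from the disc to the sphere; its value `∞` off the image of the disc is
  -- immaterial.
  refine ⟨φ, hφ, Function.extend (fun t : closedBall (0 : ℂ) (R / 4) => proj (chart p t)) G
    fun _ => ∞, fun ε hε => ?_⟩
  obtain ⟨n₀, hn₀⟩ := hG ε hε
  refine ⟨n₀, ?_⟩
  rintro n hn _ ⟨t, ht, rfl⟩
  have e := hinj.extend_apply G (fun _ => ∞) ⟨t, ht⟩
  simp only at e
  simp only
  rw [e]
  exact hn₀ n hn ⟨t, ht⟩

theorem preimage_backwardOrbit_subset (f : Sphere → Sphere) (z : Sphere) :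
    f ⁻¹' backwardOrbit f z ⊆ backwardOrbit f z := by
  intro x hx
  obtain ⟨m, hm⟩ := mem_iUnion.1 hx
  exact mem_iUnion.2 ⟨m + 1, hm⟩

theorem juliaSet_subset_closure_backwardOrbit {f : RatFunc ℂ} (hf : 2 ≤ ratDegree f) {z : Sphere}
    (hz : z ∉ exceptionalSet (ratMap f)) :
    juliaSet (ratMap f) ⊆ closure (backwardOrbit (ratMap f) z) := by
  have hinf : (backwardOrbit (ratMap f) z).Infinite := fun hfin => hz
    ⟨_, ⟨hfin, completelyInvariant_of_preimage_subset (surjective_ratMap hf) hfin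
      (preimage_backwardOrbit_subset _ _)⟩, mem_iUnion.2 ⟨0, rfl⟩⟩
  intro p hp
  by_contra hcl
  classical
  obtain ⟨s, hs, hcard⟩ := hinf.exists_subset_card_eq 3
  obtain ⟨q₁, q₂, q₃, h₁₂, h₁₃, h₂₃, rfl⟩ := Finset.card_eq_three.1 hcard
  have hU : (closure (backwardOrbit (ratMap f) z))ᶜ ∈ 𝓝 p :=
    isClosed_closure.isOpen_compl.mem_nhds hcl
  have hit : ∀ n x, (ratMap f)^[n] x ∈ backwardOrbit (ratMap f) z →
      x ∈ backwardOrbit (ratMap f) z := by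
    intro n x hx
    obtain ⟨m, hm⟩ := mem_iUnion.1 hx
    refine mem_iUnion.2 ⟨m + n, ?_⟩
    rwa [mem_preimage, Function.iterate_add_apply]
  refine hp (mem_fatouSet_of_omits hf h₁₂ h₂₃ h₁₃ hU fun n x hx => ?_)
  have hx' : ∀ q ∈ ({q₁, q₂, q₃} : Finset Sphere), (ratMap f)^[n] x ≠ q := fun q hq h =>
    hx (subset_closure (hit n x (h ▸ hs hq)))
  exact ⟨hx' _ (by simp), hx' _ (by simp), hx' _ (by simp)⟩

/-! ### The Julia set is nonempty, infinite, perfect and uncountable -/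

theorem juliaSet_nonempty {f : RatFunc ℂ} (hf : 2 ≤ ratDegree f) :
    (juliaSet (ratMap f)).Nonempty := by
  by_contra hJ
  have hF : ∀ p, p ∈ fatouSet (ratMap f) := fun p => by
    by_contra hp
    exact hJ ⟨p, hp⟩
  -- The Cauchy form passes to finite unions of sets without gluing limit functions.
  have hP : ∀ a : ℕ → ℕ, ∃ φ : ℕ → ℕ, StrictMono φ ∧ ∀ ε > 0, ∃ n₀, ∀ m ≥ n₀, ∀ n ≥ n₀,
      ∀ z ∈ (univ : Set Sphere),
        chord ((ratMap f)^[a (φ m)] z) ((ratMap f)^[a (φ n)] z) < ε := by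
    refine (isCompact_univ (X := Sphere)).induction_on (p := fun S => ∀ a : ℕ → ℕ, ∃ φ : ℕ → ℕ,
      StrictMono φ ∧ ∀ ε > 0, ∃ n₀, ∀ m ≥ n₀, ∀ n ≥ n₀, ∀ z ∈ S,
        chord ((ratMap f)^[a (φ m)] z) ((ratMap f)^[a (φ n)] z) < ε) ?_ ?_ ?_ ?_
    · exact fun a => ⟨id, strictMono_id, fun ε _ => ⟨0, by simp⟩⟩
    · intro s t hst ht a
      obtain ⟨φ, hφ, h⟩ := ht a
      refine ⟨φ, hφ, fun ε hε => ?_⟩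
      obtain ⟨n₀, h⟩ := h ε hε
      exact ⟨n₀, fun m hm n hn z hz => h m hm n hn z (hst hz)⟩
    · intro s t hs ht a
      obtain ⟨φ, hφ, h⟩ := hs a
      obtain ⟨ψ, hψ, h'⟩ := ht fun n => a (φ n)
      refine ⟨φ ∘ ψ, hφ.comp hψ, fun ε hε => ?_⟩
      obtain ⟨n₁, h⟩ := h ε hε
      obtain ⟨n₂, h'⟩ := h' ε hε
      refine ⟨max n₁ n₂, fun m hm n hn z hz => ?_⟩
      rcases hz with hz | hz
      · exact h _ ((le_of_max_le_left hm).trans (hψ.le_apply)) _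
          ((le_of_max_le_left hn).trans (hψ.le_apply)) z hz
      · exact h' m (le_of_max_le_right hm) n (le_of_max_le_right hn) z hz
    · intro p _
      obtain ⟨N, hN, hn⟩ := mem_fatouSet_iff.1 (hF p)
      refine ⟨N, mem_nhdsWithin_of_mem_nhds hN, fun a => ?_⟩
      obtain ⟨φ, hφ, g, hg⟩ := hn a
      refine ⟨φ, hφ, fun ε hε => ?_⟩
      obtain ⟨n₀, h⟩ := hg (ε / 2) (half_pos hε)
      refine ⟨n₀, fun m hm n hn z hz => ?_⟩
      have h1 := h m hm z hz
      have h2 := h n hn z hz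
      rw [chord_comm] at h2
      linarith [chord_triangle ((ratMap f)^[a (φ m)] z) (g z) ((ratMap f)^[a (φ n)] z)]
  obtain ⟨φ, hφ, hφc⟩ := hP id
  -- By surjectivity every $y$ is $f^{\varphi(n_0)}(x)$, so two close iterates yield a positive
  -- iterate close to the identity.
  have hreturn : ∀ ε > 0, ∃ m, ∀ y, chord ((ratMap f)^[m + 1] y) y < ε := by
    intro ε hε
    obtain ⟨n₀, h⟩ := hφc ε hε
    obtain ⟨m, hm⟩ := Nat.exists_eq_add_of_lt (hφ (Nat.lt_succ_self n₀))
    refine ⟨m, fun y => ?_⟩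
    obtain ⟨x, rfl⟩ := (surjective_ratMap hf).iterate (φ n₀) y
    have := h (n₀ + 1) (Nat.le_succ _) n₀ le_rfl x (mem_univ x)
    rwa [id, id, hm, add_assoc, add_comm, Function.iterate_add_apply] at this
  -- If $f(x)=f(y)$, a positive iterate near the identity sends $x$ and $y$ to the same point.
  refine not_injective_ratMap hf fun x y hxy => eq_of_chord_eq_zero ?_
  refine le_antisymm (le_of_forall_gt_imp_ge_of_dense fun ε hε => ?_) (chord_nonneg _ _)
  obtain ⟨m, hm⟩ := hreturn (ε / 2) (half_pos hε)
  have h1 := hm x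
  have h2 := hm y
  rw [Function.iterate_succ_apply, hxy, chord_comm, ← Function.iterate_succ_apply] at h1
  linarith [chord_triangle x ((ratMap f)^[m + 1] y) y]

theorem juliaSet_infinite {f : RatFunc ℂ} (hf : 2 ≤ ratDegree f) :
    (juliaSet (ratMap f)).Infinite := by
  intro hfin
  obtain ⟨p, hp⟩ := juliaSet_nonempty hf
  exact hp (exceptionalSet_subset_fatouSet hf ⟨_, ⟨hfin, completelyInvariant_of_preimage_subset
    (surjective_ratMap hf) hfin (preimage_juliaSet_subset (isOpenMap_ratMap hf))⟩, hp⟩)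

/-- Openness carries neighbourhoods of $p$ to neighbourhoods of $f(p)$, so nearby points of $S$ pull
back to points of $S$ near $p$. -/
theorem accPt_of_accPt_map {f : Sphere → Sphere} (hopen : IsOpenMap f) {S : Set Sphere}
    (hS : f ⁻¹' S ⊆ S) {p : Sphere} (h : AccPt (f p) (𝓟 S)) : AccPt p (𝓟 S) := by
  rw [accPt_iff_nhds] at h ⊢
  intro U hU
  obtain ⟨_, ⟨⟨x, hxU, rfl⟩, hxS⟩, hne⟩ := h _ (hopen.image_mem_nhds hU)
  exact ⟨x, ⟨hxU, hS hxS⟩, fun hxp => hne (congrArg f hxp)⟩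

theorem perfect_juliaSet {f : RatFunc ℂ} (hf : 2 ≤ ratDegree f) :
    Perfect (juliaSet (ratMap f)) := by
  have hopen := isOpenMap_ratMap hf
  have hclosed := isClosed_juliaSet (ratMap f)
  refine ⟨hclosed, fun p hp => ?_⟩
  obtain ⟨z, -, hz⟩ := (juliaSet_infinite hf).exists_accPt_of_subset_isCompact
    isCompact_univ (subset_univ _)
  have hzJ : z ∈ juliaSet (ratMap f) := hclosed.closure_subset hz.clusterPt.mem_closure
  have hzE : z ∉ exceptionalSet (ratMap f) := fun h => hzJ (exceptionalSet_subset_fatouSet hf h)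
  have horbit : backwardOrbit (ratMap f) z ⊆ derivedSet (juliaSet (ratMap f)) := by
    intro x hx
    obtain ⟨m, hm⟩ := mem_iUnion.1 hx
    clear hx
    induction m generalizing x with
    | zero =>
      obtain rfl : x = z := hm
      exact hz
    | succ m ih => exact accPt_of_accPt_map hopen (preimage_juliaSet_subset hopen) (ih hm)
  exact closure_minimal horbit (isClosed_derivedSet _)
    (juliaSet_subset_closure_backwardOrbit hf hzE hp)

theorem not_countable_juliaSet {f : RatFunc ℂ} (hf : 2 ≤ ratDegree f) :
    ¬ (juliaSet (ratMap f)).Countable := by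
  intro hc
  obtain ⟨g, hg, -, hginj⟩ := (perfect_juliaSet hf).exists_nat_bool_injection (juliaSet_nonempty hf)
  have hcount : (range g).Countable := hc.mono hg
  have : Countable (ℕ → Bool) := by
    rw [← image_univ] at hcount
    exact countable_univ_iff.1 (countable_of_injective_of_countable_image hginj.injOn hcount)
  -- Cantor's diagonal argument.
  obtain ⟨e, he⟩ := exists_surjective_nat (ℕ → Bool)
  obtain ⟨n, hn⟩ := he fun n => !(e n n)
  simpa using congrFun hn n

end Metric

end RationalDynamics

end

theorem mainTheorem5 (f : RatFunc ℂ) (hf : 2 ≤ RationalDynamics.ratDegree f) :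
    (∀ z : RationalDynamics.Sphere,
      z ∉ RationalDynamics.exceptionalSet (RationalDynamics.ratMap f) →
        RationalDynamics.juliaSet (RationalDynamics.ratMap f) ⊆
          closure (RationalDynamics.backwardOrbit (RationalDynamics.ratMap f) z)) ∧
    Perfect (RationalDynamics.juliaSet (RationalDynamics.ratMap f)) ∧
    ¬ (RationalDynamics.juliaSet (RationalDynamics.ratMap f)).Countable :=
  ⟨fun _ hz => RationalDynamics.juliaSet_subset_closure_backwardOrbit hf hz,
    RationalDynamics.perfect_juliaSet hf, RationalDynamics.not_countable_juliaSet hf⟩
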